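/- Let $M$ be an $m$-dimensional (Hausdorff) $C^\infty$ manifold and $\mathbf TM=TM\oplus T^*M$, with the neutral metric $g((X,\alpha),(Y,\mu))=\alpha(Y)+\mu(X)$ and the Courant bracket $$[(X,\alpha),(Y,\mu)]=\bigl([X,Y],\,L_X\mu-L_Y\alpha+\tfrac12 d(\alpha(Y)-\mu(X))\bigr).$$ Let $G$ be a generalized Riemannian metric on $M$, i.e. $G(\cdot,\cdot)=g(\phi\,\cdot,\cdot)$ is positive definite for a smooth endomorphism $\phi$ of $\mathbf TM$ with $\phi^2=\mathrm{Id}$ and $g(\phi\,\cdot,\phi\,\cdot)=g$, and let $(\gamma,\psi)$ be the corresponding pair of a Riemannian metric $\gamma$ and a $2$-form $\psi$ on $M$: the $\pm1$-eigenbundles of $\phi$ are $V_\pm=\{(X,\flat_{\psi\pm\gamma}X): X\in TM\}$, where $\flat_{\psi\pm\gamma}X=\psi(X,\cdot)\pm\gamma(X,\cdot)$. Let $D$ be the Levi-Civita connection of $\gamma$, put $D^\pm_XY=D_XY\pm\tfrac12\sharp_\gamma[d\psi(X,Y,\cdot)]$, and let $\nabla$ be the canonical big connection of $G$, i.e. the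 connection on $\mathbf TM=V_+\oplus V_-$ with $$\nabla_X(Y,\flat_{\psi\pm\gamma}Y)=(D^\pm_XY,\flat_{\psi\pm\gamma}D^\pm_XY).$$ Let $E\subset\mathbf TM$ be an almost Dirac structure, i.e. a smooth maximal $g$-isotropic subbundle (of rank $m$), let $\Psi_E$ be the endomorphism of $\mathbf TM$ with $+1$-eigenbundle $E$ and $-1$-eigenbundle $\phi(E)$, and let $F_E$ be the isometry of $(TM,\gamma)$ defined by $\Psi_E(X,\flat_{\psi+\gamma}X)=(F_EX,\flat_{\psi-\gamma}F_EX)$. Then $E$ is a parallel Dirac structure (that is, the space $\Gamma E$ of smooth sections of $E$ is closed under the Courant bracket, and $\nabla_X\mathcal Y\in\Gamma E$ for every vector field $X$ and every $\mathcal Y\in\Gamma E$) if and only if, for all vector fields $X,Y,Z$ on $M$, $$\gamma(F_EZ,(D_XF_E)Y)=\tfrac12\bigl[d\psi(X,Y,Z)+d\psi(X,F_EY,F_EZ)\bigr]$$ and $$d\psi(X,Y,Z)+d\psi(F_EX,F_EY,F_EZ)=0 .$$ -/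

import Mathlib

open scoped Manifold ContDiff Bundle

noncomputable section

namespace GenRiem

open Bundle VectorField Module

variable {m : ℕ} {M : Type*} [TopologicalSpace M] [ChartedSpace (EuclideanSpace ℝ (Fin m)) M]

/-! ### Vector fields, one-forms, sections of the big tangent bundle -/

/-- The tangent space of the `m`-dimensional manifold `M` at `x`. -/
abbrev Tan (m : ℕ) {M : Type*} [TopologicalSpace M] [ChartedSpace (EuclideanSpace ℝ (Fin m)) M]
    (x : M) : Type := TangentSpace (𝓡 m) x

/-- The fibre at `x` of the big tangent bundle `TM ⊕ T*M`. -/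
abbrev Big (m : ℕ) {M : Type*} [TopologicalSpace M] [ChartedSpace (EuclideanSpace ℝ (Fin m)) M]
    (x : M) : Type := Tan m x × (Tan m x →L[ℝ] ℝ)

instance (x : M) : FiniteDimensional ℝ (Tan m x) :=
  inferInstanceAs (FiniteDimensional ℝ (EuclideanSpace ℝ (Fin m)))

instance (x : M) : T2Space (Tan m x) :=
  inferInstanceAs (T2Space (EuclideanSpace ℝ (Fin m)))

instance (x : M) : FiniteDimensional ℝ (Tan m x →L[ℝ] ℝ) :=
  LinearEquiv.finiteDimensional
    (LinearMap.toContinuousLinearMap : (Tan m x →ₗ[ℝ] ℝ) ≃ₗ[ℝ] (Tan m x →L[ℝ] ℝ))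

theorem finrank_tan (x : M) : finrank ℝ (Tan m x) = m :=
  finrank_euclideanSpace_fin (𝕜 := ℝ) (n := m)

theorem finrank_cotan (x : M) : finrank ℝ (Tan m x →L[ℝ] ℝ) = m := by
  rw [← (LinearMap.toContinuousLinearMap :
    (Tan m x →ₗ[ℝ] ℝ) ≃ₗ[ℝ] (Tan m x →L[ℝ] ℝ)).finrank_eq]
  exact (Subspace.dual_finrank_eq (K := ℝ) (V := Tan m x)).trans (finrank_tan x)

theorem finrank_big (x : M) : finrank ℝ (Big m x) = m + m := by
  rw [finrank_prod, finrank_tan, finrank_cotan]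

section smooth

variable [IsManifold (𝓡 m) ∞ M]

/-- `X` is a `C^∞` vector field on `M`. -/
def SmoothVF (X : Π x : M, Tan m x) : Prop :=
  ContMDiff (𝓡 m) ((𝓡 m).prod 𝓘(ℝ, EuclideanSpace ℝ (Fin m))) ∞
    (fun x ↦ TotalSpace.mk' (EuclideanSpace ℝ (Fin m)) x (X x))

/-- `(X, α)` is a `C^∞` section over `U` of the big tangent bundle: its components are a `C^∞`
vector field and a `C^∞` one-form on `U`. -/
def SmoothBigOn (U : Set M) (S : Π x : M, Big m x) : Prop :=
  ContMDiffOn (𝓡 m) ((𝓡 m).prod 𝓘(ℝ, EuclideanSpace ℝ (Fin m))) ∞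
    (fun x ↦ TotalSpace.mk' (EuclideanSpace ℝ (Fin m)) x (S x).1) U ∧
  ContMDiffOn (𝓡 m) ((𝓡 m).prod 𝓘(ℝ, EuclideanSpace ℝ (Fin m) →L[ℝ] ℝ)) ∞
    (fun x ↦ TotalSpace.mk' (EuclideanSpace ℝ (Fin m) →L[ℝ] ℝ)
      (E := fun x : M ↦ Tan m x →L[ℝ] ℝ) x (S x).2) U

/-- `S` is a global `C^∞` section of the big tangent bundle. -/
def SmoothBig (S : Π x : M, Big m x) : Prop := SmoothBigOn Set.univ S

end smooth

/-- The neutral metric `g((X,α),(Y,μ)) = α(Y) + μ(X)`. -/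
def neutral {x : M} (u v : Big m x) : ℝ := u.2 v.1 + v.2 u.1

/-! ### Exterior derivative, Lie derivative, Courant bracket -/

/-- The exterior derivative of an `n`-form: read the form in the preferred chart at `x₀`, take
the exterior derivative in the model space, and pull the result back to `M`. -/
def extD {n : ℕ} (θ : Π x : M, Tan m x [⋀^Fin n]→L[ℝ] ℝ) (x₀ : M) :
    Tan m x₀ [⋀^Fin (n + 1)]→L[ℝ] ℝ :=
  (extDerivWithin
    (fun y : EuclideanSpace ℝ (Fin m) ↦
      ((θ ((extChartAt (𝓡 m) x₀).symm y)).compContinuousLinearMap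
        (mfderivWithin 𝓘(ℝ, EuclideanSpace ℝ (Fin m)) (𝓡 m) (extChartAt (𝓡 m) x₀).symm
          (Set.range (𝓡 m)) y) : EuclideanSpace ℝ (Fin m) [⋀^Fin n]→L[ℝ] ℝ))
    (Set.range (𝓡 m)) (extChartAt (𝓡 m) x₀ x₀)).compContinuousLinearMap
    (mfderiv (𝓡 m) 𝓘(ℝ, EuclideanSpace ℝ (Fin m)) (extChartAt (𝓡 m) x₀) x₀)

/-- A one-form, viewed as a field of alternating maps in one variable. -/
def oneFormAlt (μ : Π x : M, Tan m x →L[ℝ] ℝ) (x : M) : Tan m x [⋀^Fin 1]→L[ℝ] ℝ :=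
  ContinuousAlternatingMap.ofSubsingleton ℝ (Tan m x) ℝ (0 : Fin 1) (μ x)

theorem update_two {A : Type*} (v w z : A) : Function.update ![v, w] 1 z = ![v, z] := by
  ext i; fin_cases i <;> rfl

theorem update_three {A : Type*} (v w u z : A) :
    Function.update ![v, w, u] 2 z = ![v, w, z] := by
  ext i; fin_cases i <;> rfl

/-- Interior product `i(X)η = η(X, ·)` of a tangent vector with an alternating bilinear form. -/
def interior₂ {x : M} (v : Tan m x) (η : Tan m x [⋀^Fin 2]→L[ℝ] ℝ) : Tan m x →L[ℝ] ℝ :=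
  LinearMap.toContinuousLinearMap
    { toFun := fun w ↦ η ![v, w]
      map_add' := fun a b ↦ by
        have h := η.map_update_add ![v, 0] 1 a b
        rwa [update_two, update_two, update_two] at h
      map_smul' := fun c a ↦ by
        have h := η.map_update_smul ![v, 0] 1 c a
        rwa [update_two, update_two] at h }

/-- `i(Y)i(X)η = η(X, Y, ·)` for an alternating trilinear form. -/
def interior₃ {x : M} (v w : Tan m x) (η : Tan m x [⋀^Fin 3]→L[ℝ] ℝ) : Tan m x →L[ℝ] ℝ :=
  LinearMap.toContinuousLinearMap
    { toFun := fun z ↦ η ![v, w, z]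
      map_add' := fun a b ↦ by
        have h := η.map_update_add ![v, w, 0] 2 a b
        rwa [update_three, update_three, update_three] at h
      map_smul' := fun c a ↦ by
        have h := η.map_update_smul ![v, w, 0] 2 c a
        rwa [update_three, update_three] at h }

/-- The Lie derivative of a one-form, `L_X μ = i(X) dμ + d(μ(X))`. -/
def lieD (X : Π x : M, Tan m x) (μ : Π x : M, Tan m x →L[ℝ] ℝ) (x : M) : Tan m x →L[ℝ] ℝ :=
  interior₂ (X x) (extD (oneFormAlt μ) x) + mvfderiv (𝓡 m) (fun y ↦ μ y (X y)) x

/-- The Courant bracket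
`[(X,α),(Y,μ)] = ([X,Y], L_X μ - L_Y α + (1/2) d(α(Y) - μ(X)))`. -/
def courant (S T : Π x : M, Big m x) (x : M) : Big m x :=
  (mlieBracket (𝓡 m) (fun y ↦ (S y).1) (fun y ↦ (T y).1) x,
    lieD (fun y ↦ (S y).1) (fun y ↦ (T y).2) x - lieD (fun y ↦ (T y).1) (fun y ↦ (S y).2) x
      + (1 / 2 : ℝ) • mvfderiv (𝓡 m) (fun y ↦ (S y).2 (T y).1 - (T y).2 (S y).1) x)

/-! ### Riemannian metrics, two-forms, Levi-Civita connection -/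

section geometry

variable [IsManifold (𝓡 m) ∞ M]

/-- A `C^∞` Riemannian metric on `M`. -/
abbrev RMetric (m : ℕ) (M : Type*) [TopologicalSpace M]
    [ChartedSpace (EuclideanSpace ℝ (Fin m)) M] [IsManifold (𝓡 m) ∞ M] :=
  ContMDiffRiemannianMetric (𝓡 m) ∞ (EuclideanSpace ℝ (Fin m)) (fun x : M ↦ Tan m x)

/-- A `C^∞` two-form on `M`. -/
structure TwoForm (m : ℕ) (M : Type*) [TopologicalSpace M]
    [ChartedSpace (EuclideanSpace ℝ (Fin m)) M] [IsManifold (𝓡 m) ∞ M] where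
  /-- the bilinear form on each tangent space -/
  form (x : M) : Tan m x →L[ℝ] Tan m x →L[ℝ] ℝ
  alt (x : M) (v : Tan m x) : form x v v = 0
  contMDiff : ContMDiff (𝓡 m)
    ((𝓡 m).prod 𝓘(ℝ, EuclideanSpace ℝ (Fin m) →L[ℝ] EuclideanSpace ℝ (Fin m) →L[ℝ] ℝ)) ∞
    (fun x ↦ TotalSpace.mk'
      (EuclideanSpace ℝ (Fin m) →L[ℝ] EuclideanSpace ℝ (Fin m) →L[ℝ] ℝ)
      (E := fun x : M ↦ Tan m x →L[ℝ] Tan m x →L[ℝ] ℝ) x (form x))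

/-- The two-form as a field of alternating maps. -/
def TwoForm.toAlt (ψ : TwoForm m M) (x : M) : Tan m x [⋀^Fin 2]→L[ℝ] ℝ where
  toFun v := ψ.form x (v 0) (v 1)
  map_update_add' := by
    intro inst v i a b
    have h : inst = instDecidableEqFin 2 := Subsingleton.elim _ _
    subst h
    fin_cases i <;> simp
  map_update_smul' := by
    intro inst v i c a
    have h : inst = instDecidableEqFin 2 := Subsingleton.elim _ _
    subst h
    fin_cases i <;> simp
  map_eq_zero_of_eq' v i j h hij := by
    fin_cases i <;> fin_cases j <;> simp_all [ψ.alt]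
  cont := by
    have h : Continuous (fun p : Tan m x × Tan m x ↦ ψ.form x p.1 p.2) := by
      have h' := (isBoundedBilinearMap_apply (𝕜 := ℝ) (E := EuclideanSpace ℝ (Fin m))
        (F := ℝ)).continuous
      exact h'.comp (((ψ.form x).continuous.comp continuous_fst).prodMk continuous_snd)
    have h0 : Continuous (fun v : Fin 2 → Tan m x ↦ (v 0, v 1)) :=
      (continuous_apply (0 : Fin 2)).prodMk (continuous_apply (1 : Fin 2))
    exact h.comp h0

/-- The three-form `dψ`. -/
def TwoForm.d (ψ : TwoForm m M) (x : M) : Tan m x [⋀^Fin 3]→L[ℝ] ℝ := extD ψ.toAlt x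

/-- The musical isomorphism `♭_γ : T_x M → T_x^* M`. -/
def flatEquiv (γ : RMetric m M) (x : M) : Tan m x ≃ₗ[ℝ] (Tan m x →L[ℝ] ℝ) :=
  LinearEquiv.ofInjectiveOfFinrankEq (γ.inner x : Tan m x →ₗ[ℝ] (Tan m x →L[ℝ] ℝ))
    (by
      rw [injective_iff_map_eq_zero]
      intro v hv
      by_contra hne
      have h := γ.pos x v hne
      have h' : γ.inner x v v = 0 := by
        have := congrArg (fun f : Tan m x →L[ℝ] ℝ ↦ f v) hv
        simpa using this
      linarith)
    (by rw [finrank_tan, finrank_cotan])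

/-- The musical isomorphism `♯_γ : T_x^* M → T_x M`, inverse of `♭_γ`. -/
def sharp (γ : RMetric m M) (x : M) : (Tan m x →L[ℝ] ℝ) ≃ₗ[ℝ] Tan m x := (flatEquiv γ x).symm

/-- `γ(X, Y)` as a function on `M`. -/
def pair (γ : RMetric m M) (X Y : Π x : M, Tan m x) (x : M) : ℝ := γ.inner x (X x) (Y x)

/-- `X` is differentiable at `x`. -/
def DiffVF (X : Π x : M, Tan m x) (x : M) : Prop :=
  MDifferentiableAt (𝓡 m) ((𝓡 m).prod 𝓘(ℝ, EuclideanSpace ℝ (Fin m)))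
    (fun y ↦ TotalSpace.mk' (EuclideanSpace ℝ (Fin m)) y (X y)) x

theorem pair_diff (γ : RMetric m M) {X Y : Π x : M, Tan m x} {x : M}
    (hX : DiffVF X x) (hY : DiffVF Y x) :
    MDifferentiableAt (𝓡 m) 𝓘(ℝ) (pair γ X Y) x := by
  let _ : RiemannianBundle (fun x : M ↦ Tan m x) := ⟨γ.toRiemannianMetric⟩
  exact MDifferentiableAt.inner_bundle (F := EuclideanSpace ℝ (Fin m)) (E := fun x : M ↦ Tan m x)
    (b := id) hX hY

/-- The Koszul expression: half of
`X γ(Y,Z) + Y γ(X,Z) - Z γ(X,Y) + γ([X,Y],Z) - γ([X,Z],Y) - γ([Y,Z],X)`. -/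
def koszul (γ : RMetric m M) (X Y Z : Π x : M, Tan m x) (x : M) : ℝ :=
  (1 / 2) * (mvfderiv (𝓡 m) (pair γ Y Z) x (X x) + mvfderiv (𝓡 m) (pair γ X Z) x (Y x)
    - mvfderiv (𝓡 m) (pair γ X Y) x (Z x)
    + γ.inner x (mlieBracket (𝓡 m) X Y x) (Z x)
    - γ.inner x (mlieBracket (𝓡 m) X Z x) (Y x)
    - γ.inner x (mlieBracket (𝓡 m) Y Z x) (X x))

theorem pair_add_left (γ : RMetric m M) (X X' Y : Π x : M, Tan m x) :
    pair γ (X + X') Y = fun x ↦ pair γ X Y x + pair γ X' Y x := by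
  ext x; simp [pair]

theorem pair_smul_left (γ : RMetric m M) (f : M → ℝ) (X Y : Π x : M, Tan m x) :
    pair γ (f • X) Y = fun x ↦ f x * pair γ X Y x := by
  ext x; simp [pair]

theorem pair_comm (γ : RMetric m M) (X Y : Π x : M, Tan m x) : pair γ X Y = pair γ Y X := by
  ext x; exact γ.symm x _ _

theorem pair_add_right (γ : RMetric m M) (X Y Y' : Π x : M, Tan m x) :
    pair γ X (Y + Y') = fun x ↦ pair γ X Y x + pair γ X Y' x := by
  ext x; simp [pair]

theorem pair_smul_right (γ : RMetric m M) (f : M → ℝ) (X Y : Π x : M, Tan m x) :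
    pair γ X (f • Y) = fun x ↦ f x * pair γ X Y x := by
  ext x; simp [pair]

theorem koszul_tensorial_fst (γ : RMetric m M) {Y Z : Π x : M, Tan m x} {x : M}
    (hY : DiffVF Y x) (hZ : DiffVF Z x) :
    TensorialAt (𝓡 m) (EuclideanSpace ℝ (Fin m)) (fun X ↦ koszul γ X Y Z x) x where
  smul {f X} hf hX := by
    simp only [koszul, pair_smul_left, mvfderiv_fun_mul hf (pair_diff γ hX hZ),
      mvfderiv_fun_mul hf (pair_diff γ hX hY), mlieBracket_smul_left hf hX]
    simp [pair]
    rw [γ.symm x (X x) (Z x), γ.symm x (X x) (Y x)]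
    ring
  add {X X'} hX hX' := by
    simp only [koszul, pair_add_left, mvfderiv_fun_add (pair_diff γ hX hZ) (pair_diff γ hX' hZ),
      mvfderiv_fun_add (pair_diff γ hX hY) (pair_diff γ hX' hY), mlieBracket_add_left hX hX']
    simp
    ring

theorem koszul_tensorial_thd (γ : RMetric m M) {X Y : Π x : M, Tan m x} {x : M}
    (hX : DiffVF X x) (hY : DiffVF Y x) :
    TensorialAt (𝓡 m) (EuclideanSpace ℝ (Fin m)) (fun Z ↦ koszul γ X Y Z x) x where
  smul {f Z} hf hZ := by
    simp only [koszul, pair_smul_right, mvfderiv_fun_mul hf (pair_diff γ hX hZ),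
      mvfderiv_fun_mul hf (pair_diff γ hY hZ), mlieBracket_smul_right hf hZ]
    simp [pair]
    rw [γ.symm x (X x) (Z x), γ.symm x (Y x) (Z x)]
    ring
  add {Z Z'} hZ hZ' := by
    simp only [koszul, pair_add_right, mvfderiv_fun_add (pair_diff γ hX hZ) (pair_diff γ hX hZ'),
      mvfderiv_fun_add (pair_diff γ hY hZ) (pair_diff γ hY hZ'), mlieBracket_add_right hZ hZ']
    simp
    ring

theorem koszul_add_snd (γ : RMetric m M) {X Y Y' Z : Π x : M, Tan m x} {x : M}
    (hX : DiffVF X x) (hY : DiffVF Y x) (hY' : DiffVF Y' x) (hZ : DiffVF Z x) :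
    koszul γ X (Y + Y') Z x = koszul γ X Y Z x + koszul γ X Y' Z x := by
  simp only [koszul, pair_add_left, pair_add_right,
    mvfderiv_fun_add (pair_diff γ hX hY) (pair_diff γ hX hY'),
    mvfderiv_fun_add (pair_diff γ hY hZ) (pair_diff γ hY' hZ),
    mlieBracket_add_left hY hY', mlieBracket_add_right hY hY']
  simp
  ring

theorem koszul_smul_snd (γ : RMetric m M) {X Y Z : Π x : M, Tan m x} {f : M → ℝ} {x : M}
    (hf : MDifferentiableAt (𝓡 m) 𝓘(ℝ) f x)
    (hX : DiffVF X x) (hY : DiffVF Y x) (hZ : DiffVF Z x) :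
    koszul γ X (f • Y) Z x =
      f x * koszul γ X Y Z x + mvfderiv (𝓡 m) f x (X x) * γ.inner x (Y x) (Z x) := by
  simp only [koszul, pair_smul_left, pair_smul_right,
    mvfderiv_fun_mul hf (pair_diff γ hX hY), mvfderiv_fun_mul hf (pair_diff γ hY hZ),
    mlieBracket_smul_left hf hY, mlieBracket_smul_right hf hY]
  simp [pair]
  rw [γ.symm x (X x) (Y x)]
  ring

open scoped Classical in
/-- The covector-valued form `v ↦ γ(D_v Y, ·)` at `x` of the Levi-Civita connection, given by the
Koszul formula (`0` if `Y` is not differentiable at `x`). -/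
def koszulForm (γ : RMetric m M) (Y : Π x : M, Tan m x) (x : M) :
    Tan m x →L[ℝ] Tan m x →L[ℝ] ℝ :=
  if hY : DiffVF Y x then
    TensorialAt.mkHom₂ (I := 𝓡 m) (F := EuclideanSpace ℝ (Fin m))
      (F' := EuclideanSpace ℝ (Fin m)) (V := fun x : M ↦ Tan m x) (V' := fun x : M ↦ Tan m x)
      (fun X Z ↦ koszul γ X Y Z x) x
      (fun _ hZ ↦ koszul_tensorial_fst γ hY hZ) (fun _ hX ↦ koszul_tensorial_thd γ hX hY)
  else 0

theorem koszulForm_apply (γ : RMetric m M) {X Y Z : Π x : M, Tan m x} {x : M}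
    (hX : DiffVF X x) (hY : DiffVF Y x) (hZ : DiffVF Z x) :
    koszulForm γ Y x (X x) (Z x) = koszul γ X Y Z x := by
  rw [koszulForm, dif_pos hY]
  exact TensorialAt.mkHom₂_apply _ _ hX hZ

theorem exists_diffVF {x : M} (v : Tan m x) : ∃ X : Π x : M, Tan m x, DiffVF X x ∧ X x = v :=
  ⟨FiberBundle.extend (EuclideanSpace ℝ (Fin m)) v, FiberBundle.mdifferentiableAt_extend .., by simp⟩

theorem inner_sharp (γ : RMetric m M) (x : M) (α : Tan m x →L[ℝ] ℝ) (v : Tan m x) :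
    γ.inner x (sharp γ x α) v = α v :=
  congrArg (fun f : Tan m x →L[ℝ] ℝ ↦ f v) ((flatEquiv γ x).apply_symm_apply α)

theorem ext_inner (γ : RMetric m M) {x : M} {u w : Tan m x}
    (h : ∀ v, γ.inner x u v = γ.inner x w v) : u = w :=
  (flatEquiv γ x).injective (ContinuousLinearMap.ext h)

/-- The Levi-Civita connection of `γ`, defined by the Koszul formula;
`leviCivita γ Y x v` is `(D_v Y)(x)`. -/
def leviCivita (γ : RMetric m M) :
    CovariantDerivative (𝓡 m) (EuclideanSpace ℝ (Fin m)) (fun x : M ↦ Tan m x) where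
  toFun Y x := LinearMap.toContinuousLinearMap
    ((sharp γ x : (Tan m x →L[ℝ] ℝ) →ₗ[ℝ] Tan m x) ∘ₗ
      (koszulForm γ Y x : Tan m x →ₗ[ℝ] (Tan m x →L[ℝ] ℝ)))
  isCovariantDerivativeOnUniv :=
    { add := by
        intro Y Y' x hY hY' _
        ext1 v
        refine ext_inner γ fun z ↦ ?_
        obtain ⟨X, hX, rfl⟩ := exists_diffVF v
        obtain ⟨Z, hZ, rfl⟩ := exists_diffVF z
        have hs : DiffVF (Y + Y') x := mdifferentiableAt_add_section hY hY'
        simp only [add_apply, map_add]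
        simp only [LinearMap.coe_toContinuousLinearMap', LinearMap.comp_apply,
          LinearEquiv.coe_coe, ContinuousLinearMap.coe_coe, inner_sharp]
        rw [koszulForm_apply γ hX hs hZ, koszulForm_apply γ hX hY hZ, koszulForm_apply γ hX hY' hZ,
          koszul_add_snd γ hX hY hY' hZ]
      leibniz := by
        intro Y f x hY hf _
        ext1 v
        refine ext_inner γ fun z ↦ ?_
        obtain ⟨X, hX, rfl⟩ := exists_diffVF v
        obtain ⟨Z, hZ, rfl⟩ := exists_diffVF z
        have hs : DiffVF (f • Y) x := hf.smul_section hY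
        simp only [add_apply, smul_apply, map_add,
          map_smul, ContinuousLinearMap.smulRight_apply, smul_eq_mul]
        simp only [LinearMap.coe_toContinuousLinearMap', LinearMap.comp_apply,
          LinearEquiv.coe_coe, ContinuousLinearMap.coe_coe, inner_sharp]
        rw [koszulForm_apply γ hX hs hZ, koszulForm_apply γ hX hY hZ,
          koszul_smul_snd γ hf hX hY hZ] }

/-! ### Generalized Riemannian metrics and the canonical big connection -/

/-- `♭_{ψ + sγ}`, i.e. `X ↦ ψ(X, ·) + s γ(X, ·)`; used with `s = 1` and `s = -1`. -/
def flatPM (s : ℝ) (γ : RMetric m M) (ψ : TwoForm m M) (x : M) :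
    Tan m x →L[ℝ] Tan m x →L[ℝ] ℝ := ψ.form x + s • γ.inner x

/-- A generalized Riemannian metric, given by the endomorphism `φ` of the big tangent bundle with
`φ² = Id`, `g(φ·, φ·) = g` and `G = g(φ·, ·)` positive definite. -/
structure GenMetric (m : ℕ) (M : Type*) [TopologicalSpace M]
    [ChartedSpace (EuclideanSpace ℝ (Fin m)) M] [IsManifold (𝓡 m) ∞ M] where
  /-- the endomorphism of each fibre -/
  φ (x : M) : Big m x →ₗ[ℝ] Big m x
  smooth (S : Π x : M, Big m x) : SmoothBig S → SmoothBig (fun x ↦ φ x (S x))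
  invol (x : M) (u : Big m x) : φ x (φ x u) = u
  isometry (x : M) (u v : Big m x) : neutral (φ x u) (φ x v) = neutral u v
  pos (x : M) (u : Big m x) (hu : u ≠ 0) : 0 < neutral (φ x u) u

/-- The eigenbundles `V_+` (`s = 1`) and `V_-` (`s = -1`) of `φ`. -/
def GenMetric.V (G : GenMetric m M) (s : ℝ) (x : M) : Submodule ℝ (Big m x) :=
  End.eigenspace (G.φ x) s

/-- `G ↔ (γ, ψ)`: the eigenbundles of `G` are `V_± = {(X, ♭_{ψ ± γ} X) : X ∈ TM}`. -/
def GenMetric.Corresponds (G : GenMetric m M) (γ : RMetric m M) (ψ : TwoForm m M) : Prop :=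
  ∀ x : M, (G.V 1 x : Set (Big m x)) = Set.range (fun X : Tan m x ↦ (X, flatPM 1 γ ψ x X)) ∧
    (G.V (-1) x : Set (Big m x)) = Set.range (fun X : Tan m x ↦ (X, flatPM (-1) γ ψ x X))

/-- The connections `D^±_X Y = D_X Y ± (1/2) ♯_γ [i(Y) i(X) dψ]` (`s = 1` and `s = -1`);
`connPM s γ ψ Y x v` is `(D^s_v Y)(x)`. -/
def connPM (s : ℝ) (γ : RMetric m M) (ψ : TwoForm m M) (Y : Π x : M, Tan m x) (x : M)
    (v : Tan m x) : Tan m x :=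
  leviCivita γ Y x v + (s / 2) • sharp γ x (interior₃ v (Y x) (ψ.d x))

/-- The vector field `τ_± (S_±)`, where `S_± = (1/2)(Id ± φ) S` is the `V_±`-component of `S` and
`τ_± : V_± → TM` is the projection. -/
def GenMetric.comp (G : GenMetric m M) (s : ℝ) (S : Π x : M, Big m x) (x : M) : Tan m x :=
  ((1 / 2 : ℝ) • (S x + s • G.φ x (S x))).1

/-- The canonical big connection of `G ↔ (γ, ψ)`: the connection on the big tangent bundle with
`∇_X (Y, ♭_{ψ ± γ} Y) = (D^±_X Y, ♭_{ψ ± γ} D^±_X Y)`. -/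
def GenMetric.nabla (G : GenMetric m M) (γ : RMetric m M) (ψ : TwoForm m M)
    (S : Π x : M, Big m x) (x : M) (v : Tan m x) : Big m x :=
  (connPM 1 γ ψ (G.comp 1 S) x v, flatPM 1 γ ψ x (connPM 1 γ ψ (G.comp 1 S) x v)) +
  (connPM (-1) γ ψ (G.comp (-1) S) x v,
    flatPM (-1) γ ψ x (connPM (-1) γ ψ (G.comp (-1) S) x v))

/-! ### Dirac structures -/

/-- An almost Dirac structure: a `C^∞` subbundle of the big tangent bundle that is maximal
isotropic for the neutral metric, i.e. isotropic of rank `m`. -/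
structure AlmostDirac (m : ℕ) (M : Type*) [TopologicalSpace M]
    [ChartedSpace (EuclideanSpace ℝ (Fin m)) M] [IsManifold (𝓡 m) ∞ M] where
  /-- the fibres -/
  fib (x : M) : Submodule ℝ (Big m x)
  isotropic (x : M) (u : Big m x) (hu : u ∈ fib x) (v : Big m x) (hv : v ∈ fib x) :
    neutral u v = 0
  rank (x : M) : finrank ℝ (fib x) = m
  smooth (x₀ : M) : ∃ U : Set M, IsOpen U ∧ x₀ ∈ U ∧ ∃ e : Fin m → Π x : M, Big m x,
    (∀ i, SmoothBigOn U (e i)) ∧ ∀ x ∈ U, fib x = Submodule.span ℝ (Set.range (fun i ↦ e i x))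

namespace AlmostDirac

/-- `S` is a global `C^∞` section of `E`. -/
def IsSection (E : AlmostDirac m M) (S : Π x : M, Big m x) : Prop :=
  SmoothBig S ∧ ∀ x, S x ∈ E.fib x

/-- `E` is a Dirac structure: its sections are closed under the Courant bracket. -/
def IsDirac (E : AlmostDirac m M) : Prop :=
  ∀ S T : Π x : M, Big m x, E.IsSection S → E.IsSection T → ∀ x, courant S T x ∈ E.fib x

/-- The canonical big connection preserves `E`: `∇_X S ∈ ΓE` for every vector field `X` and every
`S ∈ ΓE`. -/
def IsPreserved (E : AlmostDirac m M) (G : GenMetric m M) (γ : RMetric m M) (ψ : TwoForm m M) :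
    Prop :=
  ∀ S : Π x : M, Big m x, E.IsSection S → ∀ (x : M) (v : Tan m x), G.nabla γ ψ S x v ∈ E.fib x

/-- `E` is a parallel Dirac structure on `(M, G)`. -/
def IsParallelDirac (E : AlmostDirac m M) (G : GenMetric m M) (γ : RMetric m M)
    (ψ : TwoForm m M) : Prop := E.IsDirac ∧ E.IsPreserved G γ ψ

theorem isCompl (E : AlmostDirac m M) (G : GenMetric m M) (x : M) :
    IsCompl (E.fib x) ((E.fib x).map (G.φ x)) := by
  have hinj : Function.Injective (G.φ x) := fun u v h ↦ by
    rw [← G.invol x u, h, G.invol]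
  refine (Submodule.isCompl_iff_disjoint _ _ ?_).mpr ?_
  · rw [finrank_big, (Submodule.equivMapOfInjective (G.φ x) hinj (E.fib x)).finrank_eq.symm, E.rank]
  · rw [Submodule.disjoint_def]
    rintro u hu ⟨w, hw, rfl⟩
    by_contra hne
    have h := G.pos x _ hne
    rw [G.invol, E.isotropic x _ hw _ hu] at h
    exact lt_irrefl _ h

/-- The generalized paracomplex structure `Ψ_E` with `+1`-eigenbundle `E` and `-1`-eigenbundle
`φ(E)`. -/
def para (E : AlmostDirac m M) (G : GenMetric m M) (x : M) : Big m x →ₗ[ℝ] Big m x :=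
  (E.fib x).projection _ (E.isCompl G x) -
    ((E.fib x).map (G.φ x)).projection _ (E.isCompl G x).symm

/-- The isometry `F_E` of `(TM, γ)` representing `E`: the tangent component of
`Ψ_E (X, ♭_{ψ + γ} X)`, so that `Ψ_E (X, ♭_{ψ + γ} X) = (F_E X, ♭_{ψ - γ} F_E X)`. -/
def F (E : AlmostDirac m M) (G : GenMetric m M) (γ : RMetric m M) (ψ : TwoForm m M) (x : M) :
    Tan m x →ₗ[ℝ] Tan m x :=
  LinearMap.fst ℝ _ _ ∘ₗ E.para G x ∘ₗ
    LinearMap.prod LinearMap.id (flatPM 1 γ ψ x : Tan m x →ₗ[ℝ] (Tan m x →L[ℝ] ℝ))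

end AlmostDirac

/-- `(D_X F) Y = D_X (F Y) - F (D_X Y)`, with `D` the Levi-Civita connection of `γ`. -/
def covDerivEnd (γ : RMetric m M) (F : Π x : M, Tan m x →ₗ[ℝ] Tan m x)
    (X Y : Π x : M, Tan m x) (x : M) : Tan m x :=
  leviCivita γ (fun y ↦ F y (Y y)) x (X x) - F x (leviCivita γ Y x (X x))

end geometry

end GenRiem

end

open scoped Manifold ContDiff Bundle

noncomputable section

namespace GenRiem

open Bundle VectorField Module
open scoped Topology

/-! Split each vector of the big tangent bundle into its `V_+` and `V_-` components, both recorded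
by tangent vectors. On these components the neutral metric is `2γ` and `-2γ` (`neutral_bigPt`), so a
maximal isotropic `E` is the graph of a `γ`-isometry, namely `F_E` (`AlmostDirac.mem_fib_iff`,
`AlmostDirac.inner_F`). Sections of `E` thus correspond to vector fields `Y`, through the pair `(Y,
F_E Y)`.

The big connection acts by `D^+` and `D^-` on the two components. It preserves `E` exactly when
`D^-_X (F_E Y) = F_E (D^+_X Y)`, and pairing with `F_E Z` turns this into the first condition
(`AlmostDirac.isPreserved_iff`).

Since `E` is its own orthogonal, closure under the Courant bracket means `g([S, T], R) = 0` for
sections of `E`. Write these sections as `(X_i, ♭_ψ X_i + ♭_γ W_i)` with `X_i = Y_i + F_E Y_i` and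
`W_i = Y_i - F_E Y_i`. The invariant formula for `dψ`, metric compatibility and zero torsion turn
the pairing into `dψ(X_1, X_2, X_3)` plus a cyclic sum of covariant derivatives
(`neutral_courant_bigLift`). If the connection preserves `E`, the first condition replaces that sum
by values of `dψ`, and multilinearity leaves `-2 (dψ + F_E^* dψ)`
(`AlmostDirac.neutral_courant_of_isPreserved`). So under the first condition, closure is equivalent
to the second. -/

theorem _root_.ContinuousAlternatingMap.differentiableWithinAt_of_apply {m n : ℕ}
    {θ : EuclideanSpace ℝ (Fin m) → EuclideanSpace ℝ (Fin m) [⋀^Fin n]→L[ℝ] ℝ}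
    {s : Set (EuclideanSpace ℝ (Fin m))} {y : EuclideanSpace ℝ (Fin m)}
    (h : ∀ v, DifferentiableWithinAt ℝ (fun z ↦ θ z v) s y) :
    DifferentiableWithinAt ℝ θ s y := by
  let b := (EuclideanSpace.basisFun (Fin m) ℝ).toBasis
  -- Values on basis tuples determine an alternating map, so `θ` is recovered from finitely many
  -- scalar functions by a fixed linear left inverse `R`.
  let L : (EuclideanSpace ℝ (Fin m) [⋀^Fin n]→L[ℝ] ℝ) →ₗ[ℝ] ((Fin n → Fin m) → ℝ) :=
    { toFun := fun η f ↦ η (fun i ↦ b (f i))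
      map_add' := fun _ _ ↦ rfl
      map_smul' := fun _ _ ↦ rfl }
  have hL : Function.Injective L := by
    intro η ζ h
    apply ContinuousAlternatingMap.toAlternatingMap_injective
    refine Basis.ext_alternating b fun f _ ↦ ?_
    exact congrFun h f
  obtain ⟨R, hR⟩ := L.exists_leftInverse_of_injective (LinearMap.ker_eq_bot.mpr hL)
  have hθ : θ = fun z ↦ LinearMap.toContinuousLinearMap R (L (θ z)) := by
    ext1 z
    exact (LinearMap.congr_fun hR (θ z)).symm
  rw [hθ]
  refine (LinearMap.toContinuousLinearMap R).differentiableAt.comp_differentiableWithinAt y ?_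
  exact differentiableWithinAt_pi.mpr fun f ↦ h _

variable {m : ℕ} {M : Type*} [TopologicalSpace M] [ChartedSpace (EuclideanSpace ℝ (Fin m)) M]

/-! ### Alternating trilinear forms -/

section trilinear

variable {x : M} (η : Tan m x [⋀^Fin 3]→L[ℝ] ℝ)

theorem alt_three_add (a b c d : Tan m x) : η ![a + b, c, d] = η ![a, c, d] + η ![b, c, d] :=
  η.vecCons_add _ a b

theorem alt_three_rotate (a b c : Tan m x) : η ![a, b, c] = η ![b, c, a] := by
  have h := η.toAlternatingMap.map_perm ![a, b, c] (finRotate 3)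
  have e : (![a, b, c] ∘ finRotate 3 : Fin 3 → Tan m x) = ![b, c, a] := by
    ext1 i
    fin_cases i <;> rfl
  rw [e, show Equiv.Perm.sign (finRotate 3) = 1 from by decide, one_smul] at h
  exact h.symm

/-- Expansion of an alternating trilinear form on three sums `aᵢ + bᵢ`. -/
theorem alt_three_expand (a₁ a₂ a₃ b₁ b₂ b₃ : Tan m x) :
    η ![a₁ + b₁, a₂ + b₂, a₃ + b₃]
      - (η ![a₁ + b₁, a₂, a₃] + η ![a₁ + b₁, b₂, b₃])
      - (η ![a₂ + b₂, a₃, a₁] + η ![a₂ + b₂, b₃, b₁])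
      - (η ![a₃ + b₃, a₁, a₂] + η ![a₃ + b₃, b₁, b₂]) =
    -2 * (η ![a₁, a₂, a₃] + η ![b₁, b₂, b₃]) := by
  -- Rotation carries additivity from the first slot to the other two. After expansion, each mixed
  -- monomial cancels once, while the two pure ones occur once with sign `+` and three times with
  -- sign `-`.
  have r : ∀ p q s t : Tan m x, η ![p, q + s, t] = η ![p, q, t] + η ![p, s, t] := by
    intro p q s t
    rw [alt_three_rotate, alt_three_add, ← alt_three_rotate η p, ← alt_three_rotate η p]
  have r' : ∀ p q s t : Tan m x, η ![p, t, q + s] = η ![p, t, q] + η ![p, t, s] := by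
    intro p q s t
    rw [← alt_three_rotate η (q + s), alt_three_add, alt_three_rotate η q, alt_three_rotate η s]
  simp only [alt_three_add, r, r']
  rw [alt_three_rotate η a₃ a₁ a₂, alt_three_rotate η b₃ a₁ a₂, alt_three_rotate η a₃ b₁ b₂,
    alt_three_rotate η b₃ b₁ b₂, ← alt_three_rotate η a₁ a₂ a₃, ← alt_three_rotate η a₁ b₂ a₃,
    ← alt_three_rotate η b₁ a₂ b₃, ← alt_three_rotate η b₁ b₂ b₃]
  ring

end trilinear

/-! ### Exterior derivative: chart representatives and the invariant formula -/

section extD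

theorem mvfderiv_eq_fderivWithin {f : M → ℝ} {x : M} (hf : MDifferentiableAt (𝓡 m) 𝓘(ℝ) f x)
    (v : Tan m x) :
    mvfderiv (𝓡 m) f x v =
      fderivWithin ℝ (f ∘ (extChartAt (𝓡 m) x).symm) (Set.range (𝓡 m)) (extChartAt (𝓡 m) x x) v := by
  unfold mvfderiv
  rw [hf.mfderiv]
  rfl

variable [IsManifold (𝓡 m) ∞ M]

/-- A field of alternating maps is differentiable at `x` if it takes differentiable values on
vector fields that are differentiable at `x`. -/
def DiffForm {n : ℕ} (θ : Π x : M, Tan m x [⋀^Fin n]→L[ℝ] ℝ) (x : M) : Prop :=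
  ∀ V : Fin n → Π x : M, Tan m x, (∀ i, DiffVF (V i) x) →
    MDifferentiableAt (𝓡 m) 𝓘(ℝ) (fun y ↦ θ y (fun i ↦ V i y)) x

/-- A vector field read in the preferred chart at `x`. -/
def chartVF (x : M) (X : Π x : M, Tan m x) :
    EuclideanSpace ℝ (Fin m) → EuclideanSpace ℝ (Fin m) :=
  mpullbackWithin 𝓘(ℝ, EuclideanSpace ℝ (Fin m)) (𝓡 m) (extChartAt (𝓡 m) x).symm X
    (Set.range (𝓡 m))

/-- A form read in the preferred chart at `x`. -/
def chartForm {n : ℕ} (x : M) (θ : Π x : M, Tan m x [⋀^Fin n]→L[ℝ] ℝ) :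
    EuclideanSpace ℝ (Fin m) → EuclideanSpace ℝ (Fin m) [⋀^Fin n]→L[ℝ] ℝ := fun y ↦
  (θ ((extChartAt (𝓡 m) x).symm y)).compContinuousLinearMap
        (mfderivWithin 𝓘(ℝ, EuclideanSpace ℝ (Fin m)) (𝓡 m) (extChartAt (𝓡 m) x).symm
          (Set.range (𝓡 m)) y)

/-- The derivative of the preferred chart at its own base point is the identity under the
identification of the tangent space with the model space. -/
theorem chartVF_self (x : M) (X : Π x : M, Tan m x) :
    chartVF x X (extChartAt (𝓡 m) x x) = X x := by
  have h : ∀ v : Tan m x, (mfderivWithin 𝓘(ℝ, EuclideanSpace ℝ (Fin m)) (𝓡 m)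
      (extChartAt (𝓡 m) x).symm (Set.range (𝓡 m)) (extChartAt (𝓡 m) x x)).inverse v = v :=
    fun v ↦ mfderivWithin_extChartAt_symm_inverse_apply v
  -- The chart returns to `x` only up to a propositional equality, so the values are compared in the
  -- model space.
  have h2 : ∀ z : M, z = x → (X z : EuclideanSpace ℝ (Fin m)) = X x := by rintro z rfl; rfl
  exact (h _).trans (h2 _ (extChartAt_to_inv x))

/-- Fields are pulled back by the inverse of the derivative that pulls back forms; on the chart
target this derivative is invertible and the two cancel. -/
theorem chartForm_chartVF {n : ℕ} (x : M) (θ : Π x : M, Tan m x [⋀^Fin n]→L[ℝ] ℝ)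
    (X : Fin n → Π x : M, Tan m x) {y : EuclideanSpace ℝ (Fin m)}
    (hy : y ∈ (extChartAt (𝓡 m) x).target) :
    chartForm x θ y (fun i ↦ chartVF x (X i) y) =
      θ ((extChartAt (𝓡 m) x).symm y) (fun i ↦ X i ((extChartAt (𝓡 m) x).symm y)) := by
  have h := isInvertible_mfderivWithin_extChartAt_symm (I := 𝓡 m) hy
  refine congrArg (θ ((extChartAt (𝓡 m) x).symm y)) (funext fun i ↦ ?_)
  exact ((h.inverse_apply_eq).mp rfl).symm

theorem chartForm_self {n : ℕ} (x : M) (θ : Π x : M, Tan m x [⋀^Fin n]→L[ℝ] ℝ)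
    (v : Fin n → Tan m x) : chartForm x θ (extChartAt (𝓡 m) x x) v = θ x v := by
  have h := chartForm_chartVF x θ
    (fun i ↦ FiberBundle.extend (EuclideanSpace ℝ (Fin m)) (x := x) (v i))
    (mem_extChartAt_target x)
  simp only [chartVF_self, FiberBundle.extend_apply_self] at h
  refine h.trans ?_
  rw [extChartAt_to_inv]
  simp

theorem differentiableWithinAt_chartVF {x : M} {X : Π x : M, Tan m x} (hX : DiffVF X x) :
    DifferentiableWithinAt ℝ (chartVF x X) (Set.range (𝓡 m)) (extChartAt (𝓡 m) x x) := by
  have h := MDifferentiableWithinAt.differentiableWithinAt_mpullbackWithin_vectorField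
    (mdifferentiableWithinAt_univ.mpr hX)
  rwa [Set.preimage_univ, Set.univ_inter] at h

/-- `FiberBundle.extend` is constant in the trivialization at `x`, which for the tangent bundle is
the derivative of the chart. This supplies differentiable fields representing constant vectors. -/
theorem chartVF_extend (x : M) (v : Tan m x) :
    ∀ᶠ y in 𝓝[Set.range (𝓡 m)] (extChartAt (𝓡 m) x x),
      chartVF x (FiberBundle.extend (EuclideanSpace ℝ (Fin m)) v) y = v := by
  filter_upwards [extChartAt_target_mem_nhdsWithin x] with y hy
  have h := isInvertible_mfderivWithin_extChartAt_symm (I := 𝓡 m) hy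
  have hz : (extChartAt (𝓡 m) x).symm y ∈ (chartAt (EuclideanSpace ℝ (Fin m)) x).source := by
    rw [← extChartAt_source (𝓡 m)]
    exact (extChartAt (𝓡 m) x).map_target hy
  have hL := TangentBundle.symmL_trivializationAt (𝕜 := ℝ) (I := 𝓡 m) hz
  rw [(extChartAt (𝓡 m) x).right_inv hy] at hL
  have hv : (trivializationAt (EuclideanSpace ℝ (Fin m)) (TangentSpace (𝓡 m)) x ⟨x, v⟩).2 = v := by
    have h1 := TangentBundle.continuousLinearMapAt_trivializationAt (𝕜 := ℝ) (I := 𝓡 m)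
      (mem_chart_source (EuclideanSpace ℝ (Fin m)) x)
    rw [mfderiv_extChartAt_self] at h1
    have h2 := congrFun (congrArg DFunLike.coe h1) v
    rw [Trivialization.continuousLinearMapAt_apply, Trivialization.coe_linearMapAt_of_mem _
      (FiberBundle.mem_baseSet_trivializationAt' x)] at h2
    exact h2
  refine (h.inverse_apply_eq).mpr ?_
  refine Eq.trans ?_ (congrFun (congrArg DFunLike.coe hL) v)
  have hs := congrArg (Trivialization.symmL ℝ
    (trivializationAt (EuclideanSpace ℝ (Fin m)) (TangentSpace (𝓡 m)) x)
    ((extChartAt (𝓡 m) x).symm y)) hv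
  refine Eq.trans ?_ hs
  rw [Trivialization.symmL_apply]
  · rfl
  · exact hz

/-- It suffices to evaluate on constant vectors. Near the base point these are the chart
representatives of extended fields, to which `DiffForm` applies. -/
theorem differentiableWithinAt_chartForm {n : ℕ} {x : M}
    {θ : Π x : M, Tan m x [⋀^Fin n]→L[ℝ] ℝ} (hθ : DiffForm θ x) :
    DifferentiableWithinAt ℝ (chartForm x θ) (Set.range (𝓡 m)) (extChartAt (𝓡 m) x x) := by
  refine ContinuousAlternatingMap.differentiableWithinAt_of_apply fun v ↦ ?_
  have h := (hθ (fun i ↦ FiberBundle.extend (EuclideanSpace ℝ (Fin m)) (x := x) (v i : Tan m x))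
    fun i ↦ FiberBundle.mdifferentiableAt_extend ..)
  have h' := (mdifferentiableWithinAt_univ.mpr h).differentiableWithinAt_comp_extChartAt_symm
  rw [Set.preimage_univ, Set.univ_inter] at h'
  refine h'.congr_of_eventuallyEq_of_mem ?_ (Set.mem_range_self _)
  have hv := Filter.eventually_all.mpr fun i ↦ chartVF_extend x (v i)
  filter_upwards [extChartAt_target_mem_nhdsWithin x, hv] with y hy hv
  have := chartForm_chartVF x θ
    (fun i ↦ FiberBundle.extend (EuclideanSpace ℝ (Fin m)) (x := x) (v i : Tan m x)) hy
  refine Eq.trans ?_ this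
  exact congrArg (chartForm x θ y) (funext fun i ↦ (hv i).symm)

theorem extD_eq_chartForm {n : ℕ} (θ : Π x : M, Tan m x [⋀^Fin n]→L[ℝ] ℝ) (x : M)
    (v : Fin (n + 1) → Tan m x) :
    extD θ x v = extDerivWithin (chartForm x θ) (Set.range (𝓡 m)) (extChartAt (𝓡 m) x x) v := by
  unfold extD
  rw [mfderiv_extChartAt_self]
  rfl

theorem mlieBracket_eq_chartVF (X Y : Π x : M, Tan m x) (x : M) :
    mlieBracket (𝓡 m) X Y x = lieBracketWithin ℝ (chartVF x X) (chartVF x Y) (Set.range (𝓡 m))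
      (extChartAt (𝓡 m) x x) := by
  rw [← mlieBracketWithin_univ, mlieBracketWithin_apply, mfderiv_extChartAt_self,
    Set.preimage_univ, Set.univ_inter]
  exact congrFun (congrArg DFunLike.coe ContinuousLinearMap.inverse_id) _

/-- The invariant formula for the exterior derivative. -/
theorem extD_apply {n : ℕ} {θ : Π x : M, Tan m x [⋀^Fin (n + 1)]→L[ℝ] ℝ} {x : M}
    (hθ : DiffForm θ x) {X : Fin (n + 2) → Π x : M, Tan m x} (hX : ∀ i, DiffVF (X i) x) :
    extD θ x (fun i ↦ X i x) =
      (∑ i, (-1) ^ i.val •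
        mvfderiv (𝓡 m) (fun y ↦ θ y (fun j ↦ X (i.succAbove j) y)) x (X i x)) -
      ∑ i : Fin (n + 1), ∑ j ≥ i, (-1) ^ (i + j : ℕ) •
        θ x (Matrix.vecCons (mlieBracket (𝓡 m) (X i.castSucc) (X j.succ) x)
          (j.removeNth <| i.castSucc.removeNth (fun k ↦ X k x))) := by
  have hs : UniqueDiffWithinAt ℝ (Set.range (𝓡 m)) (extChartAt (𝓡 m) x x) :=
    (𝓡 m).uniqueDiffOn _ (Set.mem_range_self _)
  -- The invariant formula holds in the model space; its derivative, bracket and evaluation terms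
  -- are then identified with those on `M`.
  have key := extDerivWithin_apply_vectorField (differentiableWithinAt_chartForm hθ)
    (V := fun i ↦ chartVF x (X i)) (fun i ↦ differentiableWithinAt_chartVF (hX i)) hs
  rw [extD_eq_chartForm]
  have h0 : (fun i ↦ chartVF x (X i) (extChartAt (𝓡 m) x x)) = fun i ↦ X i x :=
    funext fun i ↦ chartVF_self x (X i)
  rw [h0] at key
  refine key.trans (congrArg₂ (· - ·) ?_ ?_)
  · refine Finset.sum_congr rfl fun i _ ↦ congrArg _ ?_
    rw [mvfderiv_eq_fderivWithin (hθ _ fun j ↦ hX _), chartVF_self]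
    refine congrFun (congrArg DFunLike.coe ?_) _
    refine Filter.EventuallyEq.fderivWithin_eq_of_mem ?_ (Set.mem_range_self _)
    filter_upwards [extChartAt_target_mem_nhdsWithin x] with y hy
    exact chartForm_chartVF x θ (fun j ↦ X (i.succAbove j)) hy
  · refine Finset.sum_congr rfl fun i _ ↦ Finset.sum_congr rfl fun j _ ↦ congrArg _ ?_
    rw [mlieBracket_eq_chartVF]
    exact chartForm_self x θ _
/-- A one-form is differentiable at `x` as a section of the cotangent bundle. -/
def DiffOneForm (μ : Π x : M, Tan m x →L[ℝ] ℝ) (x : M) : Prop :=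
  MDifferentiableAt (𝓡 m) ((𝓡 m).prod 𝓘(ℝ, EuclideanSpace ℝ (Fin m) →L[ℝ] ℝ))
    (fun y ↦ TotalSpace.mk' (EuclideanSpace ℝ (Fin m) →L[ℝ] ℝ)
      (E := fun x : M ↦ Tan m x →L[ℝ] ℝ) y (μ y)) x

theorem DiffOneForm.apply {μ : Π x : M, Tan m x →L[ℝ] ℝ} {x : M} (hμ : DiffOneForm μ x)
    {X : Π x : M, Tan m x} (hX : DiffVF X x) :
    MDifferentiableAt (𝓡 m) 𝓘(ℝ) (fun y ↦ μ y (X y)) x := by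
  have h := MDifferentiableAt.clm_bundle_apply (F₁ := EuclideanSpace ℝ (Fin m))
    (E₁ := fun x : M ↦ Tan m x) (F₂ := ℝ) (E₂ := Bundle.Trivial M ℝ) (b := id) hμ hX
  rw [mdifferentiableAt_totalSpace] at h
  exact h.2

theorem TwoForm.apply_diff (ψ : TwoForm m M) {X Y : Π x : M, Tan m x} {x : M}
    (hX : DiffVF X x) (hY : DiffVF Y x) :
    MDifferentiableAt (𝓡 m) 𝓘(ℝ) (fun y ↦ ψ.form y (X y) (Y y)) x := by
  have h := MDifferentiableAt.clm_bundle_apply₂ (F₁ := EuclideanSpace ℝ (Fin m))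
    (E₁ := fun x : M ↦ Tan m x) (F₂ := EuclideanSpace ℝ (Fin m))
    (E₂ := fun x : M ↦ Tan m x) (F₃ := ℝ) (E₃ := Bundle.Trivial M ℝ) (b := id)
    (ψ.contMDiff.contMDiffAt.mdifferentiableAt (by simp)) hX hY
  rw [mdifferentiableAt_totalSpace] at h
  exact h.2

theorem extD_oneForm {μ : Π x : M, Tan m x →L[ℝ] ℝ} {x : M} (hμ : DiffOneForm μ x)
    {X Y : Π x : M, Tan m x} (hX : DiffVF X x) (hY : DiffVF Y x) :
    extD (oneFormAlt μ) x ![X x, Y x] =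
      mvfderiv (𝓡 m) (fun y ↦ μ y (Y y)) x (X x) - mvfderiv (𝓡 m) (fun y ↦ μ y (X y)) x (Y x)
        - μ x (mlieBracket (𝓡 m) X Y x) := by
  have hθ : DiffForm (oneFormAlt μ) x := fun V hV ↦ hμ.apply (hV 0)
  have h := extD_apply hθ (X := ![X, Y]) (fun i ↦ by fin_cases i <;> assumption)
  have h0 : (fun i ↦ (![X, Y] : Fin 2 → Π x : M, Tan m x) i x) = ![X x, Y x] := by
    ext1 i; fin_cases i <;> rfl
  rw [h0] at h
  rw [h, Fin.sum_univ_two, Fin.sum_univ_one, (by decide : Finset.Ici (0 : Fin 1) = {0}),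
    Finset.sum_singleton]
  change ((1 : ℤ) • mvfderiv (𝓡 m) (fun y ↦ μ y (Y y)) x (X x) +
    (-1 : ℤ) • mvfderiv (𝓡 m) (fun y ↦ μ y (X y)) x (Y x)) -
    (1 : ℤ) • μ x (mlieBracket (𝓡 m) X Y x) = _
  rw [one_smul, one_smul, neg_smul, one_smul, sub_eq_add_neg (mvfderiv _ _ _ _)]

theorem TwoForm.d_apply (ψ : TwoForm m M) {X Y Z : Π x : M, Tan m x} {x : M}
    (hX : DiffVF X x) (hY : DiffVF Y x) (hZ : DiffVF Z x) :
    ψ.d x ![X x, Y x, Z x] =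
      mvfderiv (𝓡 m) (fun y ↦ ψ.form y (Y y) (Z y)) x (X x)
        - mvfderiv (𝓡 m) (fun y ↦ ψ.form y (X y) (Z y)) x (Y x)
        + mvfderiv (𝓡 m) (fun y ↦ ψ.form y (X y) (Y y)) x (Z x)
        - ψ.form x (mlieBracket (𝓡 m) X Y x) (Z x)
        + ψ.form x (mlieBracket (𝓡 m) X Z x) (Y x)
        - ψ.form x (mlieBracket (𝓡 m) Y Z x) (X x) := by
  have hθ : DiffForm ψ.toAlt x := fun V hV ↦ ψ.apply_diff (hV 0) (hV 1)
  have h := extD_apply hθ (X := ![X, Y, Z]) (fun i ↦ by fin_cases i <;> assumption)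
  have h0 : (fun i ↦ (![X, Y, Z] : Fin 3 → Π x : M, Tan m x) i x) = ![X x, Y x, Z x] := by
    ext1 i; fin_cases i <;> rfl
  rw [h0] at h
  rw [TwoForm.d, h]
  -- An index pair `i ≤ j` stands for the fields numbered `i < j + 1`, so the double sum has three
  -- bracket terms.
  rw [Fin.sum_univ_three, Fin.sum_univ_two, (by decide : Finset.Ici (0 : Fin 2) = {0, 1}),
    (by decide : Finset.Ici (1 : Fin 2) = {1}), Finset.sum_singleton,
    Finset.sum_pair (by decide)]
  change ((1 : ℤ) • mvfderiv (𝓡 m) (fun y ↦ ψ.form y (Y y) (Z y)) x (X x) +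
    (-1 : ℤ) • mvfderiv (𝓡 m) (fun y ↦ ψ.form y (X y) (Z y)) x (Y x) +
    (1 : ℤ) • mvfderiv (𝓡 m) (fun y ↦ ψ.form y (X y) (Y y)) x (Z x)) -
    ((1 : ℤ) • ψ.form x (mlieBracket (𝓡 m) X Y x) (Z x) +
      (-1 : ℤ) • ψ.form x (mlieBracket (𝓡 m) X Z x) (Y x) +
      (1 : ℤ) • ψ.form x (mlieBracket (𝓡 m) Y Z x) (X x)) = _
  simp only [one_smul, neg_smul]
  ring

end extD

variable [IsManifold (𝓡 m) ∞ M]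

/-! ### Levi-Civita connection and the Courant bracket of lifted fields -/

section connection

theorem inner_leviCivita (γ : RMetric m M) {X Y Z : Π x : M, Tan m x} {x : M}
    (hX : DiffVF X x) (hY : DiffVF Y x) (hZ : DiffVF Z x) :
    γ.inner x (leviCivita γ Y x (X x)) (Z x) = koszul γ X Y Z x := by
  rw [← koszulForm_apply γ hX hY hZ]
  exact inner_sharp γ x _ _

/-- Symmetrizing the Koszul expression in `Y` and `Z` cancels everything except the derivative along
`X`. -/
theorem leviCivita_metric (γ : RMetric m M) {X Y Z : Π x : M, Tan m x} {x : M}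
    (hX : DiffVF X x) (hY : DiffVF Y x) (hZ : DiffVF Z x) :
    mvfderiv (𝓡 m) (pair γ Y Z) x (X x) =
      γ.inner x (leviCivita γ Y x (X x)) (Z x) + γ.inner x (leviCivita γ Z x (X x)) (Y x) := by
  rw [inner_leviCivita γ hX hY hZ, inner_leviCivita γ hX hZ hY]
  have h : γ.inner x (mlieBracket (𝓡 m) Y Z x) (X x)
      = - γ.inner x (mlieBracket (𝓡 m) Z Y x) (X x) := by
    rw [mlieBracket_swap_apply, map_neg]; rfl
  unfold koszul
  rw [h, pair_comm γ Z Y]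
  ring

/-- Antisymmetrizing the Koszul expression in `X` and `Y` leaves only the bracket `[X, Y]`. -/
theorem leviCivita_torsion (γ : RMetric m M) {X Y : Π x : M, Tan m x} {x : M}
    (hX : DiffVF X x) (hY : DiffVF Y x) (z : Tan m x) :
    γ.inner x (mlieBracket (𝓡 m) X Y x) z =
      γ.inner x (leviCivita γ Y x (X x)) z - γ.inner x (leviCivita γ X x (Y x)) z := by
  obtain ⟨Z, hZ, rfl⟩ := exists_diffVF z
  rw [inner_leviCivita γ hX hY hZ, inner_leviCivita γ hY hX hZ]
  have h : γ.inner x (mlieBracket (𝓡 m) Y X x) (Z x)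
      = - γ.inner x (mlieBracket (𝓡 m) X Y x) (Z x) := by
    rw [mlieBracket_swap_apply, map_neg]; rfl
  unfold koszul
  rw [h, pair_comm γ Y X]
  ring

/-- The pairing of a Courant bracket with a third section. -/
theorem neutral_courant {S T : Π x : M, Big m x} {x : M}
    (hS₁ : DiffVF (fun y ↦ (S y).1) x) (hS₂ : DiffOneForm (fun y ↦ (S y).2) x)
    (hT₁ : DiffVF (fun y ↦ (T y).1) x) (hT₂ : DiffOneForm (fun y ↦ (T y).2) x)
    {R : Π x : M, Big m x} (hR₁ : DiffVF (fun y ↦ (R y).1) x) :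
    neutral (courant S T x) (R x) =
      mvfderiv (𝓡 m) (fun y ↦ (T y).2 (R y).1) x (S x).1
      - (T x).2 (mlieBracket (𝓡 m) (fun y ↦ (S y).1) (fun y ↦ (R y).1) x)
      - mvfderiv (𝓡 m) (fun y ↦ (S y).2 (R y).1) x (T x).1
      + (S x).2 (mlieBracket (𝓡 m) (fun y ↦ (T y).1) (fun y ↦ (R y).1) x)
      + (1 / 2) * mvfderiv (𝓡 m) (fun y ↦ (S y).2 (T y).1 - (T y).2 (S y).1) x (R x).1
      + (R x).2 (mlieBracket (𝓡 m) (fun y ↦ (S y).1) (fun y ↦ (T y).1) x) := by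
  have h₁ := extD_oneForm hT₂ hS₁ hR₁
  have h₂ := extD_oneForm hS₂ hT₁ hR₁
  have e : ∀ (v w : Tan m x) (η : Tan m x [⋀^Fin 2]→L[ℝ] ℝ), interior₂ v η w = η ![v, w] :=
    fun _ _ _ ↦ rfl
  simp only [neutral, courant, lieD, add_apply, sub_apply, smul_apply, smul_eq_mul, e]
  rw [h₁, h₂]
  ring

theorem TwoForm.form_swap (ψ : TwoForm m M) {x : M} (v w : Tan m x) :
    ψ.form x v w = - ψ.form x w v := by
  have h := ψ.alt x (v + w)
  simp only [map_add, add_apply, ψ.alt] at h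
  linarith

/-- The section `(X, ♭_ψ X + ♭_γ W)` of the big tangent bundle. -/
def bigLift (γ : RMetric m M) (ψ : TwoForm m M) (X W : Π x : M, Tan m x) (x : M) : Big m x :=
  (X x, ψ.form x (X x) + γ.inner x (W x))

theorem diffOneForm_bigLift (γ : RMetric m M) (ψ : TwoForm m M) {X W : Π x : M, Tan m x} {x : M}
    (hX : DiffVF X x) (hW : DiffVF W x) : DiffOneForm (fun y ↦ (bigLift γ ψ X W y).2) x := by
  have h₁ := MDifferentiableAt.clm_bundle_apply (F₁ := EuclideanSpace ℝ (Fin m))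
    (E₁ := fun x : M ↦ Tan m x) (F₂ := EuclideanSpace ℝ (Fin m) →L[ℝ] ℝ)
    (E₂ := fun x : M ↦ Tan m x →L[ℝ] ℝ) (b := id)
    (ψ.contMDiff.contMDiffAt.mdifferentiableAt (by simp)) hX
  have h₂ := MDifferentiableAt.clm_bundle_apply (F₁ := EuclideanSpace ℝ (Fin m))
    (E₁ := fun x : M ↦ Tan m x) (F₂ := EuclideanSpace ℝ (Fin m) →L[ℝ] ℝ)
    (E₂ := fun x : M ↦ Tan m x →L[ℝ] ℝ) (b := id)
    (γ.contMDiff.contMDiffAt.mdifferentiableAt (by simp)) hW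
  exact mdifferentiableAt_add_section h₁ h₂

/-- The `ψ`-terms of the bracket assemble into the invariant formula for `dψ`; in the `γ`-terms,
metric compatibility and zero torsion replace derivatives and brackets by `D`. The hypotheses `h₁₂`
and `h₁₃` say that the first lift is `g`-orthogonal to the other two, the `ψ`-parts cancelling in
the neutral metric. -/
theorem neutral_courant_bigLift (γ : RMetric m M) (ψ : TwoForm m M)
    {X₁ X₂ X₃ W₁ W₂ W₃ : Π x : M, Tan m x} {x : M}
    (hX₁ : DiffVF X₁ x) (hX₂ : DiffVF X₂ x) (hX₃ : DiffVF X₃ x)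
    (hW₁ : DiffVF W₁ x) (hW₂ : DiffVF W₂ x) (hW₃ : DiffVF W₃ x)
    (h₁₂ : ∀ y, pair γ W₂ X₁ y = - pair γ W₁ X₂ y)
    (h₁₃ : ∀ y, pair γ W₃ X₁ y = - pair γ W₁ X₃ y) :
    neutral (courant (bigLift γ ψ X₁ W₁) (bigLift γ ψ X₂ W₂) x) (bigLift γ ψ X₃ W₃ x) =
      ψ.d x ![X₁ x, X₂ x, X₃ x]
      + (γ.inner x (leviCivita γ W₂ x (X₁ x)) (X₃ x) + γ.inner x (leviCivita γ X₂ x (X₁ x)) (W₃ x))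
      + (γ.inner x (leviCivita γ W₃ x (X₂ x)) (X₁ x) + γ.inner x (leviCivita γ X₃ x (X₂ x)) (W₁ x))
      + (γ.inner x (leviCivita γ W₁ x (X₃ x)) (X₂ x)
        + γ.inner x (leviCivita γ X₁ x (X₃ x)) (W₂ x)) := by
  -- By `h₁₂` the two pairings are opposite, so their difference is twice one of them; this cancels
  -- the `1 / 2` in the Courant bracket.
  have d₃ : mvfderiv (𝓡 m) (fun y ↦ (bigLift γ ψ X₁ W₁ y).2 (bigLift γ ψ X₂ W₂ y).1 -
      (bigLift γ ψ X₂ W₂ y).2 (bigLift γ ψ X₁ W₁ y).1) x (X₃ x) =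
      2 * (mvfderiv (𝓡 m) (fun y ↦ ψ.form y (X₁ y) (X₂ y)) x (X₃ x) +
        mvfderiv (𝓡 m) (pair γ W₁ X₂) x (X₃ x)) := by
    have hf : (fun y ↦ (bigLift γ ψ X₁ W₁ y).2 (bigLift γ ψ X₂ W₂ y).1 -
      (bigLift γ ψ X₂ W₂ y).2 (bigLift γ ψ X₁ W₁ y).1) =
      fun y ↦ (ψ.form y (X₁ y) (X₂ y) + pair γ W₁ X₂ y) +
        (ψ.form y (X₁ y) (X₂ y) + pair γ W₁ X₂ y) := by
      ext y
      have := h₁₂ y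
      simp only [pair] at this
      simp only [bigLift, add_apply, pair, this, ψ.form_swap (X₂ y) (X₁ y)]
      ring
    have hd : MDifferentiableAt (𝓡 m) 𝓘(ℝ)
        (fun y ↦ ψ.form y (X₁ y) (X₂ y) + pair γ W₁ X₂ y) x :=
      MDifferentiableAt.add (ψ.apply_diff hX₁ hX₂) (pair_diff γ hW₁ hX₂)
    rw [hf, mvfderiv_fun_add hd hd, mvfderiv_fun_add (ψ.apply_diff hX₁ hX₂) (pair_diff γ hW₁ hX₂)]
    simp only [add_apply]
    ring
  have dadd : ∀ {A B C V : Π x : M, Tan m x}, DiffVF A x → DiffVF B x → DiffVF C x →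
      mvfderiv (𝓡 m) (fun y ↦ (bigLift γ ψ A B y).2 (C y)) x (V x) =
        mvfderiv (𝓡 m) (fun y ↦ ψ.form y (A y) (C y)) x (V x)
          + mvfderiv (𝓡 m) (pair γ B C) x (V x) := by
    intro A B C V hA hB hC
    rw [← add_apply, ← mvfderiv_fun_add (ψ.apply_diff hA hC) (pair_diff γ hB hC)]
    rfl
  have d₁ := dadd (V := X₁) hX₂ hW₂ hX₃
  have d₂ := dadd (V := X₂) hX₁ hW₁ hX₃
  -- Differentiating `h₁₃` along `X₂` trades `γ(W₁, X₃)` for `γ(W₃, X₁)`, which gives the result its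
  -- cyclic shape.
  have hiso : mvfderiv (𝓡 m) (pair γ W₃ X₁) x (X₂ x) = - mvfderiv (𝓡 m) (pair γ W₁ X₃) x (X₂ x) := by
    rw [show pair γ W₃ X₁ = fun y ↦ - pair γ W₁ X₃ y from funext h₁₃]
    have := mvfderiv_neg (I := 𝓡 m) (g := pair γ W₁ X₃) (x := x)
    exact congrFun (congrArg DFunLike.coe this) _
  have key := neutral_courant (S := bigLift γ ψ X₁ W₁) (T := bigLift γ ψ X₂ W₂)
    (R := bigLift γ ψ X₃ W₃) hX₁ (diffOneForm_bigLift γ ψ hX₁ hW₁) hX₂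
    (diffOneForm_bigLift γ ψ hX₂ hW₂) hX₃
  have hs : ∀ u v : Tan m x, γ.inner x u v = γ.inner x v u := γ.symm x
  rw [key, ψ.d_apply hX₁ hX₂ hX₃]
  rw [leviCivita_metric γ hX₂ hW₃ hX₁, leviCivita_metric γ hX₂ hW₁ hX₃] at hiso
  rw [leviCivita_metric γ hX₃ hW₁ hX₂] at d₃
  rw [leviCivita_metric γ hX₁ hW₂ hX₃] at d₁
  rw [leviCivita_metric γ hX₂ hW₁ hX₃] at d₂
  have t₁ := leviCivita_torsion γ hX₁ hX₃ (W₂ x)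
  have t₂ := leviCivita_torsion γ hX₂ hX₃ (W₁ x)
  have t₃ := leviCivita_torsion γ hX₁ hX₂ (W₃ x)
  change mvfderiv (𝓡 m) (fun y ↦ (bigLift γ ψ X₂ W₂ y).2 (X₃ y)) x (X₁ x)
    - (ψ.form x (X₂ x) (mlieBracket (𝓡 m) X₁ X₃ x) + γ.inner x (W₂ x) (mlieBracket (𝓡 m) X₁ X₃ x))
    - mvfderiv (𝓡 m) (fun y ↦ (bigLift γ ψ X₁ W₁ y).2 (X₃ y)) x (X₂ x)
    + (ψ.form x (X₁ x) (mlieBracket (𝓡 m) X₂ X₃ x) + γ.inner x (W₁ x) (mlieBracket (𝓡 m) X₂ X₃ x))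
    + (1 / 2) * mvfderiv (𝓡 m) (fun y ↦ (bigLift γ ψ X₁ W₁ y).2 (bigLift γ ψ X₂ W₂ y).1 -
      (bigLift γ ψ X₂ W₂ y).2 (bigLift γ ψ X₁ W₁ y).1) x (X₃ x)
    + (ψ.form x (X₃ x) (mlieBracket (𝓡 m) X₁ X₂ x)
      + γ.inner x (W₃ x) (mlieBracket (𝓡 m) X₁ X₂ x)) = _
  rw [d₁, d₂, d₃, ψ.form_swap (X₂ x), ψ.form_swap (X₁ x) (mlieBracket (𝓡 m) X₂ X₃ x),
    ψ.form_swap (X₃ x) (mlieBracket (𝓡 m) X₁ X₂ x), hs (W₂ x), hs (W₁ x), hs (W₃ x), t₁, t₂, t₃]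
  linear_combination -hiso

end connection

/-! ### Fibrewise algebra: `E` as the graph of an isometry -/

section algebra

/-- The vector `(a, ♭_{ψ+γ} a) + (b, ♭_{ψ-γ} b)` of `V_+ ⊕ V_-`. -/
def bigPt (γ : RMetric m M) (ψ : TwoForm m M) (x : M) (a b : Tan m x) : Big m x :=
  (a, flatPM 1 γ ψ x a) + (b, flatPM (-1) γ ψ x b)

/-- Passes from the `V_±` splitting to the form of `bigLift`, with `X = a + b` and `W = a - b`. -/
theorem bigPt_eq (γ : RMetric m M) (ψ : TwoForm m M) (x : M) (a b : Tan m x) :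
    bigPt γ ψ x a b = (a + b, ψ.form x (a + b) + γ.inner x (a - b)) := by
  refine Prod.ext rfl ?_
  simp only [bigPt, flatPM, Prod.snd_add, add_apply, smul_apply, map_add, map_sub]
  module

/-- `ψ` drops out by antisymmetry, and `V_+`, `V_-` are orthogonal. -/
theorem neutral_bigPt (γ : RMetric m M) (ψ : TwoForm m M) (x : M) (a b c d : Tan m x) :
    neutral (bigPt γ ψ x a b) (bigPt γ ψ x c d) = 2 * (γ.inner x a c - γ.inner x b d) := by
  simp only [bigPt_eq, neutral, add_apply, map_add, map_sub, sub_apply]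
  rw [γ.symm x c a, γ.symm x d a, γ.symm x c b, γ.symm x d b, ψ.form_swap c a, ψ.form_swap d a,
    ψ.form_swap c b, ψ.form_swap d b]
  ring

/-- The tangent component of the `V_±`-component of a vector. -/
def GenMetric.compAt (G : GenMetric m M) (s : ℝ) (x : M) : Big m x →ₗ[ℝ] Tan m x :=
  LinearMap.fst ℝ _ _ ∘ₗ ((1 / 2 : ℝ) • (LinearMap.id + s • G.φ x))

theorem GenMetric.comp_eq (G : GenMetric m M) (s : ℝ) (S : Π x : M, Big m x) (x : M) :
    G.comp s S x = G.compAt s x (S x) := rfl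

section components

variable {G : GenMetric m M} {γ : RMetric m M} {ψ : TwoForm m M}

/-- `(Id + φ) / 2` projects onto `V_+`, whose elements are determined by their tangent component. -/
theorem GenMetric.Corresponds.half_add (hG : G.Corresponds γ ψ) (x : M) (u : Big m x) :
    (1 / 2 : ℝ) • (u + G.φ x u) = (G.compAt 1 x u, flatPM 1 γ ψ x (G.compAt 1 x u)) := by
  have h : (1 / 2 : ℝ) • (u + G.φ x u) ∈ (G.V 1 x : Set (Big m x)) := by
    simp only [GenMetric.V, SetLike.mem_coe, End.mem_eigenspace_iff, map_smul, map_add, G.invol,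
      one_smul]
    rw [add_comm]
  rw [(hG x).1] at h
  obtain ⟨a, ha⟩ := h
  have h1 : a = G.compAt 1 x u := by
    have := congrArg Prod.fst ha
    simpa [GenMetric.compAt] using this
  rw [← ha, ← h1]

theorem GenMetric.Corresponds.half_sub (hG : G.Corresponds γ ψ) (x : M) (u : Big m x) :
    (1 / 2 : ℝ) • (u - G.φ x u) = (G.compAt (-1) x u, flatPM (-1) γ ψ x (G.compAt (-1) x u)) := by
  have h : (1 / 2 : ℝ) • (u - G.φ x u) ∈ (G.V (-1) x : Set (Big m x)) := by
    simp only [GenMetric.V, SetLike.mem_coe, End.mem_eigenspace_iff, map_smul, map_sub, G.invol]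
    module
  rw [(hG x).2] at h
  obtain ⟨a, ha⟩ := h
  have h1 : a = G.compAt (-1) x u := by
    have := congrArg Prod.fst ha
    simpa [GenMetric.compAt, sub_eq_add_neg] using this
  rw [← ha, ← h1]

theorem GenMetric.Corresponds.bigPt_compAt (hG : G.Corresponds γ ψ) (x : M) (u : Big m x) :
    bigPt γ ψ x (G.compAt 1 x u) (G.compAt (-1) x u) = u := by
  rw [bigPt, ← hG.half_add, ← hG.half_sub]
  module

theorem GenMetric.Corresponds.φ_bigPt (hG : G.Corresponds γ ψ) (x : M) (a b : Tan m x) :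
    G.φ x (bigPt γ ψ x a b) = (a, flatPM 1 γ ψ x a) - (b, flatPM (-1) γ ψ x b) := by
  have h₁ : (a, flatPM 1 γ ψ x a) ∈ (G.V 1 x : Set (Big m x)) := by
    rw [(hG x).1]; exact ⟨a, rfl⟩
  have h₂ : (b, flatPM (-1) γ ψ x b) ∈ (G.V (-1) x : Set (Big m x)) := by
    rw [(hG x).2]; exact ⟨b, rfl⟩
  simp only [GenMetric.V, SetLike.mem_coe, End.mem_eigenspace_iff] at h₁ h₂
  rw [bigPt, map_add, h₁, h₂]
  module

theorem GenMetric.Corresponds.compAt_one_bigPt (hG : G.Corresponds γ ψ) (x : M) (a b : Tan m x) :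
    G.compAt 1 x (bigPt γ ψ x a b) = a := by
  have h := congrArg Prod.fst (hG.half_add x (bigPt γ ψ x a b))
  rw [hG.φ_bigPt] at h
  refine h.symm.trans ?_
  change (1 / 2 : ℝ) • ((a + b) + (a - b)) = a
  module

theorem GenMetric.Corresponds.compAt_neg_one_bigPt (hG : G.Corresponds γ ψ)
    (x : M) (a b : Tan m x) :
    G.compAt (-1) x (bigPt γ ψ x a b) = b := by
  have h := congrArg Prod.fst (hG.half_sub x (bigPt γ ψ x a b))
  rw [hG.φ_bigPt] at h
  refine h.symm.trans ?_
  change (1 / 2 : ℝ) • ((a + b) - (a - b)) = b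
  module

theorem GenMetric.Corresponds.neutral_eq (hG : G.Corresponds γ ψ) (x : M) (u v : Big m x) :
    neutral u v = 2 * (γ.inner x (G.compAt 1 x u) (G.compAt 1 x v) -
      γ.inner x (G.compAt (-1) x u) (G.compAt (-1) x v)) := by
  rw [← neutral_bigPt γ ψ, hG.bigPt_compAt, hG.bigPt_compAt]

end components

theorem inner_self_eq_zero_iff (γ : RMetric m M) {x : M} {v : Tan m x} :
    γ.inner x v v = 0 ↔ v = 0 := by
  refine ⟨fun h ↦ ?_, fun h ↦ by simp [h]⟩
  by_contra hv
  exact (γ.pos x v hv).ne' h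

namespace AlmostDirac

variable {G : GenMetric m M} {γ : RMetric m M} {ψ : TwoForm m M}
  (E : AlmostDirac m M)

theorem para_of_mem (G : GenMetric m M) {x : M} {u : Big m x} (hu : u ∈ E.fib x) :
    E.para G x u = u := by
  rw [para, LinearMap.sub_apply, Submodule.projection_apply_of_mem_left _ hu,
    (Submodule.projection_apply_eq_zero_iff _).mpr hu, sub_zero]

theorem para_φ_of_mem (G : GenMetric m M) {x : M} {u : Big m x} (hu : u ∈ E.fib x) :
    E.para G x (G.φ x u) = - G.φ x u := by
  have h : G.φ x u ∈ (E.fib x).map (G.φ x) := Submodule.mem_map_of_mem hu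
  rw [para, LinearMap.sub_apply, Submodule.projection_apply_of_mem_left _ h,
    (Submodule.projection_apply_eq_zero_iff _).mpr h, zero_sub]

/-- On `E`, the `V_-`-component is the image under `F_E` of the `V_+`-component. -/
theorem F_compAt (hG : G.Corresponds γ ψ) {x : M} {u : Big m x} (hu : u ∈ E.fib x) :
    E.F G γ ψ x (G.compAt 1 x u) = G.compAt (-1) x u := by
  have h : E.para G x (G.compAt 1 x u, flatPM 1 γ ψ x (G.compAt 1 x u)) =
      (G.compAt (-1) x u, flatPM (-1) γ ψ x (G.compAt (-1) x u)) := by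
    rw [← hG.half_add, ← hG.half_sub, map_smul, map_add, E.para_of_mem G hu, E.para_φ_of_mem G hu,
      sub_eq_add_neg]
  exact congrArg Prod.fst h

/-- By isotropy the two components of a vector of `E` have equal `γ`-norm, so `E` meets `V_-`
trivially. Projection to the `V_+` component is then injective, hence bijective because both
dimensions are `m`. -/
theorem exists_mem_compAt_eq (hG : G.Corresponds γ ψ)
    (x : M) (v : Tan m x) : ∃ u ∈ E.fib x, G.compAt 1 x u = v := by
  let L : E.fib x →ₗ[ℝ] Tan m x := G.compAt 1 x ∘ₗ (E.fib x).subtype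
  have hL : Function.Injective L := by
    rw [injective_iff_map_eq_zero]
    intro u hu
    have h := E.isotropic x u u.2 u u.2
    have hu' : G.compAt 1 x (u : Big m x) = 0 := hu
    rw [hG.neutral_eq, hu'] at h
    have hb : G.compAt (-1) x (u : Big m x) = 0 := by
      rw [← inner_self_eq_zero_iff γ]
      simpa using h
    have := hG.bigPt_compAt x u
    rw [hu', hb] at this
    refine Subtype.ext (this.symm.trans ?_)
    simp [bigPt]
  let _ : AddCommGroup (E.fib x) := Submodule.addCommGroup (E.fib x)
  obtain ⟨u, hu⟩ := (LinearEquiv.ofInjectiveOfFinrankEq L hL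
    ((E.rank x).trans (finrank_tan x).symm)).surjective v
  exact ⟨u, u.2, hu⟩

theorem inner_F (hG : G.Corresponds γ ψ) (x : M) (v w : Tan m x) :
    γ.inner x (E.F G γ ψ x v) (E.F G γ ψ x w) = γ.inner x v w := by
  obtain ⟨u, hu, rfl⟩ := E.exists_mem_compAt_eq hG x v
  obtain ⟨u', hu', rfl⟩ := E.exists_mem_compAt_eq hG x w
  rw [E.F_compAt hG hu, E.F_compAt hG hu']
  have h := E.isotropic x u hu u' hu'
  rw [hG.neutral_eq] at h
  linarith

theorem F_surjective (hG : G.Corresponds γ ψ) (x : M) : Function.Surjective (E.F G γ ψ x) := by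
  rw [← LinearMap.injective_iff_surjective, injective_iff_map_eq_zero]
  intro v hv
  rw [← inner_self_eq_zero_iff γ, ← E.inner_F hG, hv]
  simp

theorem mem_fib_iff (hG : G.Corresponds γ ψ) {x : M} {u : Big m x} :
    u ∈ E.fib x ↔ G.compAt (-1) x u = E.F G γ ψ x (G.compAt 1 x u) := by
  refine ⟨fun hu ↦ (E.F_compAt hG hu).symm, fun h ↦ ?_⟩
  obtain ⟨u', hu', h'⟩ := E.exists_mem_compAt_eq hG x (G.compAt 1 x u)
  have h'' : G.compAt (-1) x u' = G.compAt (-1) x u := by rw [h, ← h', E.F_compAt hG hu']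
  have he : u' = u := by rw [← hG.bigPt_compAt x u, ← hG.bigPt_compAt x u', h', h'']
  exact he ▸ hu'

theorem bigPt_mem_fib (hG : G.Corresponds γ ψ)
    (x : M) (v : Tan m x) : bigPt γ ψ x v (E.F G γ ψ x v) ∈ E.fib x := by
  rw [E.mem_fib_iff hG, hG.compAt_one_bigPt, hG.compAt_neg_one_bigPt]

/-- This is `E^⊥ ⊆ E`. The test vectors run through `E`, and surjectivity of `F_E` makes them detect
the graph equation. -/
theorem mem_fib_of_neutral_eq_zero (hG : G.Corresponds γ ψ) {x : M} {u : Big m x}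
    (h : ∀ v : Tan m x, neutral u (bigPt γ ψ x v (E.F G γ ψ x v)) = 0) : u ∈ E.fib x := by
  rw [E.mem_fib_iff hG]
  refine ext_inner γ fun w ↦ ?_
  obtain ⟨v, rfl⟩ := E.F_surjective hG x w
  have hv := h v
  rw [hG.neutral_eq, hG.compAt_one_bigPt, hG.compAt_neg_one_bigPt] at hv
  rw [E.inner_F hG]
  linarith

end AlmostDirac

end algebra

/-! ### Global smooth sections and smoothness of `F_E` -/

section smoothness

theorem SmoothVF.diffVF {X : Π x : M, Tan m x} (hX : SmoothVF X) (x : M) : DiffVF X x :=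
  hX.contMDiffAt.mdifferentiableAt (by simp)

theorem SmoothVF.add {X Y : Π x : M, Tan m x} (hX : SmoothVF X) (hY : SmoothVF Y) :
    SmoothVF (fun x ↦ X x + Y x) :=
  ContMDiff.add_section hX hY

theorem SmoothVF.sub {X Y : Π x : M, Tan m x} (hX : SmoothVF X) (hY : SmoothVF Y) :
    SmoothVF (fun x ↦ X x - Y x) :=
  ContMDiff.sub_section hX hY

theorem SmoothVF.const_smul {X : Π x : M, Tan m x} (hX : SmoothVF X) (c : ℝ) :
    SmoothVF (fun x ↦ c • X x) :=
  ContMDiff.const_smul_section hX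

theorem exists_bump [T2Space M] {U : Set M} {x : M} (hU : U ∈ 𝓝 x) :
    ∃ f : M → ℝ, ContMDiff (𝓡 m) 𝓘(ℝ) ∞ f ∧ f x = 1 ∧ tsupport f ⊆ U := by
  obtain ⟨f, -, hf⟩ := (SmoothBumpFunction.nhds_basis_tsupport (I := 𝓡 m) x).mem_iff.mp hU
  exact ⟨f, f.contMDiff, f.eq_one, hf⟩

/-- Allows identities between tensors, stated for global fields, to be tested at arbitrary tangent
vectors. -/
theorem exists_smoothVF [T2Space M] {x : M} (v : Tan m x) :
    ∃ X : Π x : M, Tan m x, SmoothVF X ∧ X x = v := by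
  obtain ⟨s, hs, hX⟩ := FiberBundle.exists_contMDiffOn_extend (k := ∞) (𝓡 m)
    (EuclideanSpace ℝ (Fin m)) (V := fun x : M ↦ Tan m x) v
  obtain ⟨f, hf, hfx, hfs⟩ := exists_bump (m := m) (interior_mem_nhds.mpr hs)
  refine ⟨f • FiberBundle.extend (EuclideanSpace ℝ (Fin m)) v,
    ContMDiffOn.smul_section_of_tsupport hf.contMDiffOn isOpen_interior hfs
      (hX.mono interior_subset), ?_⟩
  simp [hfx]

/-- A local section of the big tangent bundle becomes global after multiplication by a bump
function. -/
theorem exists_smoothBig [T2Space M] {U : Set M} (hU : IsOpen U) {x : M} (hx : x ∈ U) :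
    ∃ f : M → ℝ, f x = 1 ∧ (∀ y ∉ U, f y = 0) ∧
      ∀ S : Π x : M, Big m x, SmoothBigOn U S → SmoothBig (fun y ↦ f y • S y) := by
  obtain ⟨f, hf, hfx, hfs⟩ := exists_bump (m := m) (hU.mem_nhds hx)
  refine ⟨f, hfx, fun y hy ↦ image_eq_zero_of_notMem_tsupport fun h ↦ hy (hfs h),
    fun S hS ↦ ⟨?_, ?_⟩⟩
  · exact (ContMDiffOn.smul_section_of_tsupport hf.contMDiffOn hU hfs hS.1).contMDiffOn
  · exact (ContMDiffOn.smul_section_of_tsupport (s := fun y ↦ (S y).2)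
      hf.contMDiffOn hU hfs hS.2).contMDiffOn

theorem GenMetric.smoothVF_comp (G : GenMetric m M) (s : ℝ) {S : Π x : M, Big m x}
    (hS : SmoothBig S) : SmoothVF (G.comp s S) := by
  have h₁ : SmoothVF (fun x ↦ (S x).1) := contMDiffOn_univ.mp hS.1
  have h₂ : SmoothVF (fun x ↦ (G.φ x (S x)).1) := contMDiffOn_univ.mp (G.smooth S hS).1
  exact (h₁.add (h₂.const_smul s)).const_smul (1 / 2)

theorem contMDiffAt_inner (γ : RMetric m M) {Z : Π x : M, Tan m x} {x : M}
    (hZ : ContMDiffAt (𝓡 m) ((𝓡 m).prod 𝓘(ℝ, EuclideanSpace ℝ (Fin m))) ∞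
      (fun y ↦ TotalSpace.mk' (EuclideanSpace ℝ (Fin m)) y (Z y)) x) :
    ContMDiffAt (𝓡 m) ((𝓡 m).prod 𝓘(ℝ, EuclideanSpace ℝ (Fin m) →L[ℝ] ℝ)) ∞
      (fun y ↦ TotalSpace.mk' (EuclideanSpace ℝ (Fin m) →L[ℝ] ℝ)
        (E := fun x : M ↦ Tan m x →L[ℝ] ℝ) y (γ.inner y (Z y))) x :=
  ContMDiffAt.clm_bundle_apply (F₁ := EuclideanSpace ℝ (Fin m))
    (E₁ := fun x : M ↦ Tan m x) (F₂ := EuclideanSpace ℝ (Fin m) →L[ℝ] ℝ)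
    (E₂ := fun x : M ↦ Tan m x →L[ℝ] ℝ) (b := id) γ.contMDiff.contMDiffAt hZ

theorem contMDiffAt_form (ψ : TwoForm m M) {Z : Π x : M, Tan m x} {x : M}
    (hZ : ContMDiffAt (𝓡 m) ((𝓡 m).prod 𝓘(ℝ, EuclideanSpace ℝ (Fin m))) ∞
      (fun y ↦ TotalSpace.mk' (EuclideanSpace ℝ (Fin m)) y (Z y)) x) :
    ContMDiffAt (𝓡 m) ((𝓡 m).prod 𝓘(ℝ, EuclideanSpace ℝ (Fin m) →L[ℝ] ℝ)) ∞
      (fun y ↦ TotalSpace.mk' (EuclideanSpace ℝ (Fin m) →L[ℝ] ℝ)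
        (E := fun x : M ↦ Tan m x →L[ℝ] ℝ) y (ψ.form y (Z y))) x :=
  ContMDiffAt.clm_bundle_apply (F₁ := EuclideanSpace ℝ (Fin m))
    (E₁ := fun x : M ↦ Tan m x) (F₂ := EuclideanSpace ℝ (Fin m) →L[ℝ] ℝ)
    (E₂ := fun x : M ↦ Tan m x →L[ℝ] ℝ) (b := id) ψ.contMDiff.contMDiffAt hZ

theorem contMDiff_pair (γ : RMetric m M) {X Y : Π x : M, Tan m x}
    (hX : SmoothVF X) (hY : SmoothVF Y) : ContMDiff (𝓡 m) 𝓘(ℝ) ∞ (pair γ X Y) := by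
  intro x
  have h := ContMDiffAt.clm_bundle_apply (F₁ := EuclideanSpace ℝ (Fin m))
    (E₁ := fun x : M ↦ Tan m x) (F₂ := ℝ) (E₂ := Bundle.Trivial M ℝ) (b := id)
    (contMDiffAt_inner γ hX.contMDiffAt) (hY.contMDiffAt (x := x))
  rw [contMDiffAt_totalSpace] at h
  exact h.2

theorem smoothBig_bigPt (γ : RMetric m M) (ψ : TwoForm m M) {Y Z : Π x : M, Tan m x}
    (hY : SmoothVF Y) (hZ : SmoothVF Z) : SmoothBig (fun x ↦ bigPt γ ψ x (Y x) (Z x)) := by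
  simp only [bigPt_eq]
  refine ⟨(hY.add hZ).contMDiffOn, ContMDiff.contMDiffOn fun x ↦ ?_⟩
  exact (contMDiffAt_form ψ (hY.add hZ).contMDiffAt).add_section
    (contMDiffAt_inner γ (hY.sub hZ).contMDiffAt)

/-- A vector field is smooth at `x` if its scalar products with a frame at `x` are. -/
theorem contMDiffAt_of_pair (γ : RMetric m M) {W : Π x : M, Tan m x} {x₀ : M}
    {Z : Fin m → Π x : M, Tan m x} (hZ : ∀ j, SmoothVF (Z j))
    (hspan : ∀ w : Tan m x₀, (∀ j, γ.inner x₀ (Z j x₀) w = 0) → w = 0)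
    (h : ∀ j, ContMDiffAt (𝓡 m) 𝓘(ℝ) ∞ (pair γ (Z j) W) x₀) :
    ContMDiffAt (𝓡 m) ((𝓡 m).prod 𝓘(ℝ, EuclideanSpace ℝ (Fin m))) ∞
      (fun y ↦ TotalSpace.mk' (EuclideanSpace ℝ (Fin m)) y (W y)) x₀ := by
  let e := trivializationAt (EuclideanSpace ℝ (Fin m)) (fun x : M ↦ Tan m x) x₀
  have hx₀ : x₀ ∈ e.baseSet := FiberBundle.mem_baseSet_trivializationAt' x₀
  -- In the trivialization at `x₀`, `A x` sends a vector to its products with the `Z j x`. It varies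
  -- smoothly and is invertible at `x₀`, so near `x₀` the coordinates of `W` are `(A x)⁻¹` applied
  -- to the given smooth products.
  let A : M → EuclideanSpace ℝ (Fin m) →L[ℝ] (Fin m → ℝ) := fun x ↦
    ContinuousLinearMap.pi fun j ↦ (γ.inner x (Z j x)).comp (e.symmL ℝ x)
  have hA : ContMDiffAt (𝓡 m) 𝓘(ℝ, EuclideanSpace ℝ (Fin m) →L[ℝ] (Fin m → ℝ)) ∞ A x₀ := by
    let Φ : (Fin m → EuclideanSpace ℝ (Fin m) →L[ℝ] ℝ) →ₗ[ℝ]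
        (EuclideanSpace ℝ (Fin m) →L[ℝ] (Fin m → ℝ)) :=
      { toFun := ContinuousLinearMap.pi
        map_add' := fun _ _ ↦ rfl
        map_smul' := fun _ _ ↦ rfl }
    have hc : ContMDiffAt (𝓡 m) 𝓘(ℝ, Fin m → EuclideanSpace ℝ (Fin m) →L[ℝ] ℝ) ∞
        (fun x j ↦ (γ.inner x (Z j x)).comp (e.symmL ℝ x)) x₀ := by
      refine contMDiffAt_pi_space.mpr fun j ↦ ?_
      have h1 := (contMDiffAt_hom_bundle (E₁ := fun x : M ↦ Tan m x)
        (E₂ := Bundle.Trivial M ℝ) _).mp (contMDiffAt_inner γ (hZ j).contMDiffAt (x := x₀))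
      refine h1.2.congr_of_eventuallyEq (Filter.Eventually.of_forall fun x ↦ ?_)
      have ht : (trivializationAt ℝ (Bundle.Trivial M ℝ) x₀).continuousLinearMapAt ℝ x =
          ContinuousLinearMap.id ℝ ℝ := Bundle.Trivial.continuousLinearMapAt_trivialization ..
      simp only [ContinuousLinearMap.inCoordinates, ht]
      rfl
    exact (LinearMap.toContinuousLinearMap Φ).contDiff.contDiffAt.contMDiffAt.comp x₀ hc
  have hinj : Function.Injective (A x₀) := by
    rw [injective_iff_map_eq_zero]
    intro w hw
    have h0 : e.symmL ℝ x₀ w = 0 := hspan _ fun j ↦ congrFun hw j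
    have := congrArg (e.continuousLinearMapAt ℝ x₀) h0
    rwa [e.continuousLinearMapAt_symmL hx₀, map_zero] at this
  let L : EuclideanSpace ℝ (Fin m) ≃L[ℝ] (Fin m → ℝ) :=
    (LinearEquiv.ofInjectiveOfFinrankEq (A x₀ : EuclideanSpace ℝ (Fin m) →ₗ[ℝ] (Fin m → ℝ)) hinj
      (by simp)).toContinuousLinearEquiv
  have hL : (L : EuclideanSpace ℝ (Fin m) →L[ℝ] (Fin m → ℝ)) = A x₀ := by ext; rfl
  have hinv : ContMDiffAt (𝓡 m) 𝓘(ℝ, (Fin m → ℝ) →L[ℝ] EuclideanSpace ℝ (Fin m)) ∞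
      (fun x ↦ (A x).inverse) x₀ := by
    have h1 := contDiffAt_map_inverse (𝕜 := ℝ) (n := ∞) L
    rw [hL] at h1
    exact h1.contMDiffAt.comp x₀ hA
  have hnear : ∀ᶠ x in 𝓝 x₀, (A x).IsInvertible := by
    have := L.nhds
    rw [hL] at this
    exact hA.continuousAt this
  rw [contMDiffAt_section]
  have hrhs : ContMDiffAt (𝓡 m) 𝓘(ℝ, Fin m → ℝ) ∞ (fun x ↦ fun j ↦ pair γ (Z j) W x) x₀ :=
    contMDiffAt_pi_space.mpr h
  refine (hinv.clm_apply hrhs).congr_of_eventuallyEq ?_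
  filter_upwards [hnear, e.open_baseSet.mem_nhds hx₀] with x hx hxe
  symm
  rw [hx.inverse_apply_eq]
  ext j
  change γ.inner x (Z j x) (W x) = γ.inner x (Z j x) (e.symmL ℝ x _)
  congr 1
  have := e.symmL_continuousLinearMapAt (R := ℝ) hxe (W x)
  rw [e.continuousLinearMapAt_apply ℝ, e.coe_linearMapAt_of_mem hxe] at this
  exact this.symm

namespace AlmostDirac

variable {G : GenMetric m M} {γ : RMetric m M} {ψ : TwoForm m M}
  (E : AlmostDirac m M)

/-- Every fibre of `E` is spanned by the values of `m` global sections. -/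
theorem exists_sections [T2Space M] (x₀ : M) : ∃ S : Fin m → Π x : M, Big m x,
    (∀ i, E.IsSection (S i)) ∧ E.fib x₀ = Submodule.span ℝ (Set.range fun i ↦ S i x₀) := by
  obtain ⟨U, hU, hx₀, e, he, hspan⟩ := E.smooth x₀
  obtain ⟨f, hf1, hf0, hf⟩ := exists_smoothBig (m := m) hU hx₀
  refine ⟨fun i y ↦ f y • e i y, fun i ↦ ⟨hf _ (he i), fun y ↦ ?_⟩, ?_⟩
  · by_cases hy : y ∈ U
    · refine Submodule.smul_mem _ _ ?_
      rw [hspan y hy]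
      exact Submodule.subset_span ⟨i, rfl⟩
    · simp [hf0 y hy]
  · simp only [hf1, one_smul]
    exact hspan x₀ hx₀

/-- A section of `E` has smooth components `a` and `F_E a`, and `γ(F_E a, F_E Y) = γ(a, Y)` is
smooth. Sections spanning `E` at `x₀` have `V_-` components spanning the tangent space there, so
`contMDiffAt_of_pair` applies. -/
theorem smoothVF_F (hG : G.Corresponds γ ψ) [T2Space M] {Y : Π x : M, Tan m x} (hY : SmoothVF Y) :
    SmoothVF (fun x ↦ E.F G γ ψ x (Y x)) := by
  intro x₀
  obtain ⟨S, hS, hspan⟩ := E.exists_sections x₀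
  refine contMDiffAt_of_pair γ (Z := fun j ↦ G.comp (-1) (S j))
    (fun j ↦ G.smoothVF_comp (-1) (hS j).1) ?_ fun j ↦ ?_
  · intro w hw
    obtain ⟨v, rfl⟩ := E.F_surjective hG x₀ w
    obtain ⟨u, hu, rfl⟩ := E.exists_mem_compAt_eq hG x₀ v
    rw [E.F_compAt hG hu] at hw ⊢
    have hall : ∀ u' ∈ E.fib x₀, γ.inner x₀ (G.compAt (-1) x₀ u') (G.compAt (-1) x₀ u) = 0 := by
      intro u' hu'
      rw [hspan] at hu'
      induction hu' using Submodule.span_induction with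
      | mem z hz => obtain ⟨j, rfl⟩ := hz; exact hw j
      | zero => simp
      | add a b _ _ ha hb => simp [ha, hb]
      | smul c a _ ha => simp [ha]
    exact (inner_self_eq_zero_iff γ).mp (hall u hu)
  · have h : pair γ (G.comp (-1) (S j)) (fun x ↦ E.F G γ ψ x (Y x)) = pair γ (G.comp 1 (S j)) Y := by
      ext x
      simp only [pair, G.comp_eq]
      rw [← E.F_compAt hG ((hS j).2 x), E.inner_F hG]
    rw [h]
    exact contMDiff_pair γ (G.smoothVF_comp 1 (hS j).1) hY x₀

theorem isSection_bigPt (hG : G.Corresponds γ ψ)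
    [T2Space M] {Y : Π x : M, Tan m x} (hY : SmoothVF Y) :
    E.IsSection (fun x ↦ bigPt γ ψ x (Y x) (E.F G γ ψ x (Y x))) :=
  ⟨smoothBig_bigPt γ ψ hY (E.smoothVF_F hG hY), fun x ↦ E.bigPt_mem_fib hG x _⟩

end AlmostDirac

end smoothness

/-! ### Parallelism and integrability of `E` -/

section parallel

theorem leviCivita_add (γ : RMetric m M) {Y Z : Π x : M, Tan m x} {x : M}
    (hY : DiffVF Y x) (hZ : DiffVF Z x) (v : Tan m x) :
    leviCivita γ (fun y ↦ Y y + Z y) x v = leviCivita γ Y x v + leviCivita γ Z x v :=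
  congrFun (congrArg DFunLike.coe
    ((leviCivita γ).isCovariantDerivativeOnUniv.add hY hZ (Set.mem_univ x))) v

theorem leviCivita_sub (γ : RMetric m M) {Y Z : Π x : M, Tan m x} {x : M}
    (hY : DiffVF Y x) (hZ : DiffVF Z x) (v : Tan m x) :
    leviCivita γ (fun y ↦ Y y - Z y) x v = leviCivita γ Y x v - leviCivita γ Z x v := by
  have h := leviCivita_add γ (mdifferentiableAt_sub_section hY hZ) hZ v
  have e : (fun y ↦ (Y - Z) y + Z y) = Y := by
    ext1 y
    exact sub_add_cancel (Y y) (Z y)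
  rw [e] at h
  exact eq_sub_of_add_eq h.symm

namespace AlmostDirac

variable {G : GenMetric m M} {γ : RMetric m M} {ψ : TwoForm m M}
  (E : AlmostDirac m M)

/-- Every tangent vector is some `F_E z`, so equality can be tested by pairing with these. The
isometry removes `F_E` from the `♯` term of `D^+`, leaving `dψ(v, Y, z)`. -/
theorem connPM_F_eq_iff (hG : G.Corresponds γ ψ) (Y : Π x : M, Tan m x) (x : M) (v : Tan m x) :
    connPM (-1) γ ψ (fun y ↦ E.F G γ ψ y (Y y)) x v = E.F G γ ψ x (connPM 1 γ ψ Y x v) ↔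
      ∀ z : Tan m x, γ.inner x (E.F G γ ψ x z)
        (leviCivita γ (fun y ↦ E.F G γ ψ y (Y y)) x v - E.F G γ ψ x (leviCivita γ Y x v)) =
        (1 / 2 : ℝ) * (ψ.d x ![v, Y x, z] + ψ.d x ![v, E.F G γ ψ x (Y x), E.F G γ ψ x z]) := by
  have e : ∀ (a b c : Tan m x), γ.inner x (sharp γ x (interior₃ a b (ψ.d x))) c = ψ.d x ![a, b, c] :=
    fun a b c ↦ inner_sharp γ x _ c
  have key : ∀ z : Tan m x,
      γ.inner x (connPM (-1) γ ψ (fun y ↦ E.F G γ ψ y (Y y)) x v) (E.F G γ ψ x z) -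
        γ.inner x (E.F G γ ψ x (connPM 1 γ ψ Y x v)) (E.F G γ ψ x z) =
      γ.inner x (E.F G γ ψ x z)
        (leviCivita γ (fun y ↦ E.F G γ ψ y (Y y)) x v - E.F G γ ψ x (leviCivita γ Y x v)) -
        (1 / 2 : ℝ) * (ψ.d x ![v, Y x, z] + ψ.d x ![v, E.F G γ ψ x (Y x), E.F G γ ψ x z]) := by
    intro z
    rw [E.inner_F hG, map_sub, γ.symm x (E.F G γ ψ x z), γ.symm x (E.F G γ ψ x z), E.inner_F hG]
    simp only [connPM, map_add, map_smul, add_apply, smul_apply, smul_eq_mul, e]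
    ring
  constructor
  · intro h z
    have := key z
    rw [h, sub_self] at this
    linarith
  · intro h
    refine ext_inner γ fun w ↦ ?_
    obtain ⟨z, rfl⟩ := E.F_surjective hG x w
    have := key z
    rw [h z, sub_self] at this
    linarith

theorem comp_neg_one_eq (hG : G.Corresponds γ ψ) {S : Π x : M, Big m x} (hS : ∀ x, S x ∈ E.fib x) :
    G.comp (-1) S = fun x ↦ E.F G γ ψ x (G.comp 1 S x) := by
  ext1 x
  exact (E.F_compAt hG (hS x)).symm

/-- The connection respects the `V_±` splitting, so membership in `E` is the graph equation between
the `D^+` and `D^-` components. -/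
theorem nabla_mem_fib_iff (hG : G.Corresponds γ ψ)
    {S : Π x : M, Big m x} (hS : ∀ x, S x ∈ E.fib x) (x : M) (v : Tan m x) :
    G.nabla γ ψ S x v ∈ E.fib x ↔
      connPM (-1) γ ψ (fun y ↦ E.F G γ ψ y (G.comp 1 S y)) x v =
        E.F G γ ψ x (connPM 1 γ ψ (G.comp 1 S) x v) := by
  have h : G.nabla γ ψ S x v =
      bigPt γ ψ x (connPM 1 γ ψ (G.comp 1 S) x v) (connPM (-1) γ ψ (G.comp (-1) S) x v) := rfl
  rw [h, E.mem_fib_iff hG, hG.compAt_one_bigPt, hG.compAt_neg_one_bigPt, E.comp_neg_one_eq hG hS]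

variable [T2Space M]

theorem isPreserved_iff (hG : G.Corresponds γ ψ) : E.IsPreserved G γ ψ ↔
    ∀ X Y Z : Π x : M, Tan m x, SmoothVF X → SmoothVF Y → SmoothVF Z → ∀ x : M,
      γ.inner x (E.F G γ ψ x (Z x)) (covDerivEnd γ (E.F G γ ψ) X Y x) =
        (1 / 2 : ℝ) * (ψ.d x ![X x, Y x, Z x] +
          ψ.d x ![X x, E.F G γ ψ x (Y x), E.F G γ ψ x (Z x)]) := by
  constructor
  · intro h X Y Z hX hY hZ x
    have hS := E.isSection_bigPt hG hY
    have hc : G.comp 1 (fun x ↦ bigPt γ ψ x (Y x) (E.F G γ ψ x (Y x))) = Y := by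
      ext1 y
      exact hG.compAt_one_bigPt y _ _
    have := (E.nabla_mem_fib_iff hG hS.2 x (X x)).mp (h _ hS x (X x))
    rw [hc] at this
    exact (E.connPM_F_eq_iff hG Y x (X x)).mp this (Z x)
  · intro h S hS x v
    rw [E.nabla_mem_fib_iff hG hS.2, E.connPM_F_eq_iff hG]
    intro z
    obtain ⟨X, hX, rfl⟩ := exists_smoothVF v
    obtain ⟨Z, hZ, rfl⟩ := exists_smoothVF z
    exact h X _ Z hX (G.smoothVF_comp 1 hS.1) hZ x

/-- If `E` is preserved by the big connection, the Courant tensor of `E` is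
`-2 (dψ + F_E^* dψ)`. -/
theorem neutral_courant_of_isPreserved (hG : G.Corresponds γ ψ) (h : E.IsPreserved G γ ψ)
    {Y₁ Y₂ Y₃ : Π x : M, Tan m x} (h₁ : SmoothVF Y₁) (h₂ : SmoothVF Y₂) (h₃ : SmoothVF Y₃)
    (x : M) :
    neutral (courant (fun y ↦ bigPt γ ψ y (Y₁ y) (E.F G γ ψ y (Y₁ y)))
      (fun y ↦ bigPt γ ψ y (Y₂ y) (E.F G γ ψ y (Y₂ y))) x)
      (bigPt γ ψ x (Y₃ x) (E.F G γ ψ x (Y₃ x))) =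
    -2 * (ψ.d x ![Y₁ x, Y₂ x, Y₃ x] +
      ψ.d x ![E.F G γ ψ x (Y₁ x), E.F G γ ψ x (Y₂ x), E.F G γ ψ x (Y₃ x)]) := by
  have hF₁ := E.smoothVF_F hG h₁
  have hF₂ := E.smoothVF_F hG h₂
  have hF₃ := E.smoothVF_F hG h₃
  have hb : ∀ Y : Π x : M, Tan m x, (fun y ↦ bigPt γ ψ y (Y y) (E.F G γ ψ y (Y y))) =
      bigLift γ ψ (fun y ↦ Y y + E.F G γ ψ y (Y y)) (fun y ↦ Y y - E.F G γ ψ y (Y y)) :=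
    fun Y ↦ funext fun y ↦ bigPt_eq γ ψ y _ _
  -- Isotropy of `E`, in the form required by `neutral_courant_bigLift`.
  have hiso : ∀ Y Z : Π x : M, Tan m x, ∀ y,
      pair γ (fun y ↦ Z y - E.F G γ ψ y (Z y)) (fun y ↦ Y y + E.F G γ ψ y (Y y)) y =
      - pair γ (fun y ↦ Y y - E.F G γ ψ y (Y y)) (fun y ↦ Z y + E.F G γ ψ y (Z y)) y := by
    intro Y Z y
    have e := E.inner_F hG y (Y y) (Z y)
    simp only [pair, map_add, map_sub, sub_apply]
    rw [γ.symm y (Z y) (Y y), γ.symm y (E.F G γ ψ y (Z y)) (Y y),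
      γ.symm y (Z y) (E.F G γ ψ y (Y y)), γ.symm y (E.F G γ ψ y (Z y)) (E.F G γ ψ y (Y y)), e]
    ring
  -- The left side reduces to `2γ(D_X Y, Z) - 2γ(D_X (F_E Y), F_E Z)`, which is `-2γ(F_E Z, (D_X
  -- F_E) Y)`.
  have hpar : ∀ {X Y Z : Π x : M, Tan m x}, SmoothVF X → SmoothVF Y → SmoothVF Z →
      γ.inner x (leviCivita γ (fun y ↦ Y y - E.F G γ ψ y (Y y)) x (X x))
        (Z x + E.F G γ ψ x (Z x)) +
      γ.inner x (leviCivita γ (fun y ↦ Y y + E.F G γ ψ y (Y y)) x (X x))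
        (Z x - E.F G γ ψ x (Z x)) =
      - (ψ.d x ![X x, Y x, Z x] + ψ.d x ![X x, E.F G γ ψ x (Y x), E.F G γ ψ x (Z x)]) := by
    intro X Y Z hX hY hZ
    have hFY := E.smoothVF_F hG hY
    have k := (E.isPreserved_iff hG).mp h X Y Z hX hY hZ x
    rw [covDerivEnd, map_sub, E.inner_F hG, γ.symm x (E.F G γ ψ x (Z x)), γ.symm x (Z x)] at k
    rw [leviCivita_sub γ (hY.diffVF x) (hFY.diffVF x), leviCivita_add γ (hY.diffVF x) (hFY.diffVF x)]
    simp only [map_add, map_sub, add_apply, sub_apply]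
    linear_combination -2 * k
  have hb₃ := congrFun (hb Y₃) x
  rw [hb Y₁, hb Y₂, hb₃, neutral_courant_bigLift γ ψ ((h₁.add hF₁).diffVF x)
    ((h₂.add hF₂).diffVF x) ((h₃.add hF₃).diffVF x) ((h₁.sub hF₁).diffVF x)
    ((h₂.sub hF₂).diffVF x) ((h₃.sub hF₃).diffVF x) (hiso Y₁ Y₂) (hiso Y₁ Y₃),
    hpar (h₁.add hF₁) h₂ h₃, hpar (h₂.add hF₂) h₃ h₁, hpar (h₃.add hF₃) h₁ h₂,
    ← alt_three_expand]
  ring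

/-- As `E` is isotropic and equals its orthogonal, a bracket of sections lies in `E` exactly when it
pairs to zero with `E`; that pairing has already been computed. -/
theorem isDirac_iff_of_isPreserved (hG : G.Corresponds γ ψ) (h : E.IsPreserved G γ ψ) : E.IsDirac ↔
    ∀ X Y Z : Π x : M, Tan m x, SmoothVF X → SmoothVF Y → SmoothVF Z → ∀ x : M,
      ψ.d x ![X x, Y x, Z x] +
        ψ.d x ![E.F G γ ψ x (X x), E.F G γ ψ x (Y x), E.F G γ ψ x (Z x)] = 0 := by
  constructor
  · intro hD X Y Z hX hY hZ x
    have k := E.neutral_courant_of_isPreserved hG h hX hY hZ x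
    rw [E.isotropic x _ (hD _ _ (E.isSection_bigPt hG hX) (E.isSection_bigPt hG hY) x) _
      (E.bigPt_mem_fib hG x _)] at k
    linarith
  · intro hd S T hS hT x
    have hlift : ∀ {S : Π x : M, Big m x}, E.IsSection S →
        S = fun y ↦ bigPt γ ψ y (G.comp 1 S y) (E.F G γ ψ y (G.comp 1 S y)) := by
      intro S hS
      ext1 y
      rw [G.comp_eq, E.F_compAt hG (hS.2 y), hG.bigPt_compAt]
    refine E.mem_fib_of_neutral_eq_zero hG fun v ↦ ?_
    obtain ⟨Z, hZ, rfl⟩ := exists_smoothVF v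
    have hS' := G.smoothVF_comp 1 hS.1
    have hT' := G.smoothVF_comp 1 hT.1
    rw [hlift hS, hlift hT, E.neutral_courant_of_isPreserved hG h hS' hT' hZ,
      hd _ _ _ hS' hT' hZ x, mul_zero]

end AlmostDirac

end parallel

end GenRiem

end

theorem proposition3p5 {m : ℕ} {M : Type*} [TopologicalSpace M] [T2Space M]
    [ChartedSpace (EuclideanSpace ℝ (Fin m)) M] [IsManifold (𝓡 m) ∞ M]
    (G : GenRiem.GenMetric m M) (γ : GenRiem.RMetric m M) (ψ : GenRiem.TwoForm m M)
    (hG : G.Corresponds γ ψ) (E : GenRiem.AlmostDirac m M) :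
    E.IsParallelDirac G γ ψ ↔
      (∀ X Y Z : Π x : M, GenRiem.Tan m x,
        GenRiem.SmoothVF X → GenRiem.SmoothVF Y → GenRiem.SmoothVF Z → ∀ x : M,
          γ.inner x (E.F G γ ψ x (Z x)) (GenRiem.covDerivEnd γ (E.F G γ ψ) X Y x) =
            (1 / 2 : ℝ) * (ψ.d x ![X x, Y x, Z x] +
              ψ.d x ![X x, E.F G γ ψ x (Y x), E.F G γ ψ x (Z x)])) ∧
      (∀ X Y Z : Π x : M, GenRiem.Tan m x,
        GenRiem.SmoothVF X → GenRiem.SmoothVF Y → GenRiem.SmoothVF Z → ∀ x : M,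
          ψ.d x ![X x, Y x, Z x] +
            ψ.d x ![E.F G γ ψ x (X x), E.F G γ ψ x (Y x), E.F G γ ψ x (Z x)] = 0) := by

  unfold GenRiem.AlmostDirac.IsParallelDirac
  -- Parallelism goes first, since the Courant tensor takes its simple form only under it.
  rw [and_comm, ← E.isPreserved_iff hG]
  exact and_congr_right fun h ↦ E.isDirac_iff_of_isPreserved hG h
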